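/- **Setting.** Let $H=-\Delta+|x|^2$ be the harmonic oscillator on $\mathbb R^2$ and, for $N\ge 0$, let $E_N=\{u\in L^2(\mathbb R^2;\mathbb C): Hu=(2N+2)u\}$ (in the sense of tempered distributions), a subspace of dimension $N+1$. The continuous resonant system (CR) is $$ i\,\partial_t u=\mathcal T(u,u,u),\qquad u(0)=f, $$ $$ \mathcal T(f_1,f_2,f_3)(z)=\int_{\mathbb R}\int_{\mathbb R^2} f_1(x+z)\,f_2(\lambda x^\perp+z)\,\overline{f_3(x+\lambda x^\perp+z)}\,dx\,d\lambda,\qquad x^\perp=(-x_2,x_1). $$ It is globally well-posed in $L^2(\mathbb R^2)$: there is a unique map $\Phi:\mathbb R\times L^2(\mathbb R^2)\to L^2(\mathbb R^2)$ such that, for every $f\in L^2(\mathbb R^2)$, the curve $t\mapsto\Phi(t)f$ is differentiable with values in $L^2(\mathbb R^2)$, satisfies (CR) in $L^2(\mathbb R^2)$ for all $t\in\mathbb R$, and $\Phi(0)f=f$. The flow leaves each $E_N$ stable: $\Phi(t)E_N\subset E_N$ for all $t\in\mathbb R$. Let $(\Omega,\mathcal F,\mathbf p)$ be a probability space carrying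 independent standard complex Gaussian variables $g_{N,0},\dots,g_{N,N}$ (each of density $\frac1\pi e^{-|z|^2}$ with respect to Lebesgue measure on $\mathbb C$), let $(\phi_{N,k})_{0\le k\le N}$ be any orthonormal basis of $E_N$, and let $\mu_N$ be the law on $E_N$ of $$ \gamma_N=\frac1{\sqrt{N+1}}\sum_{k=0}^N g_{N,k}\,\phi_{N,k}. $$ **Theorem.** For every $N\ge 1$ (and every choice of the data above), the measure $\mu_N$ is invariant under the flow $\Phi$ of (CR) restricted to $E_N$: for every $t\in\mathbb R$, the map $\Phi(t):E_N\to E_N$ is measurable and the image of $\mu_N$ under it is $\mu_N$. Moreover, for $\mu_N$-almost every $u_0\in E_N$ there is a sequence of times $t_n\to+\infty$ such that $$ \lim_{n\to+\infty}\big\|\Phi(t_n)u_0-u_0\big\|_{L^2(\mathbb R^2)}=0. $$ The well-posedness of (CR) in $L^2(\mathbb R^2)$, the stability of $E_N$ for $N\ge1$, and $\dim E_N=N+1$ for $N\ge 1$, stated in the setting, are part of the assertion. -/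

import Mathlib

open MeasureTheory ProbabilityTheory Filter Topology
open scoped SchwartzMap Laplacian

noncomputable section

namespace CRSystem

/-- The plane `ℝ²` with its Euclidean norm and Lebesgue measure. -/
abbrev Plane : Type := EuclideanSpace ℝ (Fin 2)

/-- The complex Hilbert space `L²(ℝ²)`. -/
abbrev L2 : Type := Lp ℂ 2 (volume : Measure Plane)

/-- `L²(ℝ²)` carries its Borel sigma-algebra (and its subspaces the induced one). -/
instance instMeasurableSpaceL2 : MeasurableSpace L2 := borel L2

instance instBorelSpaceL2 : BorelSpace L2 := ⟨rfl⟩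

/-- The rotation by a right angle, `x^⊥ = (-x₂, x₁)`. -/
def perp (x : Plane) : Plane := !₂[-x 1, x 0]

/-- The trilinear operator of the continuous resonant system: the integral over all the rectangles
with vertices `z`, `x + z`, `λ x^⊥ + z`, `x + λ x^⊥ + z`. -/
def crT (f₁ f₂ f₃ : Plane → ℂ) (z : Plane) : ℂ :=
  ∫ lam : ℝ, ∫ x : Plane,
    f₁ (x + z) * f₂ (lam • perp x + z) * (starRingEnd ℂ) (f₃ (x + lam • perp x + z))

/-- `u : ℝ → L²(ℝ²)` is a global solution of `i ∂ₜ u = T(u, u, u)`: it is differentiable in time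
with values in `L²`, and the equation holds in `L²` at every time. -/
def IsCRSolution (u : ℝ → L2) : Prop :=
  ∀ t : ℝ, ∃ v : L2, HasDerivAt u v t ∧
    (fun z => Complex.I * v z) =ᵐ[volume] crT (u t) (u t) (u t)

/-- `Φ` is a global flow of the continuous resonant system on `L²(ℝ²)`: for every initial datum `f`,
`t ↦ Φ t f` is a global solution equal to `f` at time `0`. -/
def IsCRFlow (Φ : ℝ → L2 → L2) : Prop :=
  ∀ f : L2, Φ 0 f = f ∧ IsCRSolution (fun t => Φ t f)

/-- The harmonic oscillator `H = -Δ + |x|²`, acting on tempered distributions. -/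
def harmonicOscillator : 𝓢'(Plane, ℂ) →L[ℂ] 𝓢'(Plane, ℂ) :=
  TemperedDistribution.smulLeftCLM ℂ (fun x : Plane => ((‖x‖ ^ 2 : ℝ) : ℂ)) -
    LineDeriv.laplacianCLM ℂ Plane 𝓢'(Plane, ℂ)

/-- The eigenspace `E_N = {u ∈ L²(ℝ²) : H u = (2N + 2) u}` of the harmonic oscillator. -/
def eigenspace (N : ℕ) : Submodule ℂ L2 where
  carrier := {u | harmonicOscillator (Lp.toTemperedDistribution u) =
    (2 * N + 2 : ℂ) • Lp.toTemperedDistribution u}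
  add_mem' := by
    intro u v hu hv
    simp only [Set.mem_ofPred_eq, ← Lp.toTemperedDistributionCLM_apply] at hu hv ⊢
    rw [map_add, map_add, hu, hv, smul_add]
  zero_mem' := by
    simp only [Set.mem_ofPred_eq, ← Lp.toTemperedDistributionCLM_apply]
    rw [map_zero, map_zero, smul_zero]
  smul_mem' := by
    intro c u hu
    simp only [Set.mem_ofPred_eq, ← Lp.toTemperedDistributionCLM_apply] at hu ⊢
    rw [map_smul, map_smul, hu, smul_comm]

/-- The standard complex Gaussian law, with density `π⁻¹ exp(-|z|²)`. -/
def complexGaussian : Measure ℂ :=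
  (volume : Measure ℂ).withDensity
    (fun z => ENNReal.ofReal (Real.pi⁻¹ * Real.exp (-‖z‖ ^ 2)))

/-- The random function `γ_N = (N + 1)^{-1/2} ∑ₖ gₖ φₖ` with values in `E_N`. -/
def gammaN {Ω : Type*} {N : ℕ} (φ : OrthonormalBasis (Fin (N + 1)) ℂ (eigenspace N))
    (g : Fin (N + 1) → Ω → ℂ) (ω : Ω) : eigenspace N :=
  ((Real.sqrt ((N : ℝ) + 1) : ℂ)⁻¹) • ∑ k, g k ω • φ k

/-- The measure `μ_N` on `E_N`: the law of `γ_N`. -/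
def muN {Ω : Type*} [MeasurableSpace Ω] (P : Measure Ω) {N : ℕ}
    (φ : OrthonormalBasis (Fin (N + 1)) ℂ (eigenspace N)) (g : Fin (N + 1) → Ω → ℂ) :
    Measure (eigenspace N) :=
  P.map (gammaN φ g)

end CRSystem

end

/-! On `E_N` the system is an ordinary differential equation in finitely many real dimensions. Its
vector field is tangent to the spheres and divergence-free, so the flow preserves both the norm and
Lebesgue measure. The Gaussian measure has a density with respect to Lebesgue measure that depends
on the norm alone (`muN_eq`), hence it is invariant. Being a probability measure, it is subject to
Poincaré recurrence.

Three facts about the trilinear operator feed this argument. First, it is bounded on `L²`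
(`lintegral_sq_crKernel_le`): Cauchy-Schwarz over rectangles leaves only the Jacobians `(1 + λ²)⁻¹`,
whose integral is `π`. Second, relabelling the vertices of a rectangle gives the symmetries
`inner_crOp_conj` and `inner_crOp_swap`. They make `⟪u, T(u,u,u)⟫` real, which is conservation of
mass, and they make the relevant diagonal coefficients of the linearization real, which kills the
divergence (`divergence_eigenField`). The field is Lipschitz on balls and conserves the norm, so
`exists_curve` yields global solutions.

Third, `E_N` is stable. Ladder operators identify `E_N` with the span of the Hermite functions of
degree `N` (`eigenspace_eq_map`); the inclusion that is not algebraic rests on the completeness of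
Hermite functions. In the quadrilinear form at fixed `λ`, a creation operator on the first argument
can be moved onto the last two as annihilation operators (`crForm_raise`). By induction the form
vanishes unless the degrees satisfy `n₁ + n₂ = n₃ + n₄` (`crForm_hermite_eq_zero`), so three inputs
of degree `N` only produce an output of degree `N`.

Liouville's theorem is proved with Lipschitz test functions
(`measurePreserving_of_divergence_eq_zero`). This class is preserved by composition with a
norm-preserving flow that is Lipschitz on balls, so differentiability of the flow in the initial
datum is never needed; Rademacher's theorem takes its place. -/

noncomputable section

namespace CRSystem

/-! ### Global integral curves of vector fields tangent to the spheres -/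

section ODE

open Set Metric

variable {H : Type*} [NormedAddCommGroup H] [NormedSpace ℝ H]
  {X : H → H} {N : H → H →L[ℝ] ℝ}

/-- A curve whose velocity is everywhere tangent to the spheres has constant norm. -/
theorem norm_eq_of_tangent (hN : ∀ u : H, HasFDerivAt (fun v : H => ‖v‖ ^ 2) (N u) u)
    (hX : ∀ u, N u (X u) = 0) {γ : ℝ → H} {c : ℝ → ℝ} {s : Set ℝ} (hs : Convex ℝ s)
    (hγ : ∀ t ∈ s, HasDerivWithinAt γ (c t • X (γ t)) s t) {a b : ℝ} (ha : a ∈ s) (hb : b ∈ s) :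
    ‖γ a‖ = ‖γ b‖ := by
  have h : ∀ t ∈ s, HasDerivWithinAt (fun t => ‖γ t‖ ^ 2) 0 s t := by
    intro t ht
    have := (hN (γ t)).comp_hasDerivWithinAt t (hγ t ht)
    rwa [map_smul, hX, smul_zero] at this
  have h2 := hs.norm_image_sub_le_of_norm_hasDerivWithin_le (C := 0) h (by simp) ha hb
  have h3 : ‖γ b‖ ^ 2 - ‖γ a‖ ^ 2 = 0 := by simpa using h2
  have h4 : ‖γ a‖ ^ 2 = ‖γ b‖ ^ 2 := by linarith
  exact (sq_eq_sq₀ (norm_nonneg _) (norm_nonneg _)).1 h4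

/-- The cutoff `r ↦ max 0 (min 1 (2 - r / R))` applied to the norm. -/
def normCutoff (R : ℝ) (u : H) : ℝ := max 0 (min 1 (2 - ‖u‖ / R))

omit [NormedSpace ℝ H] in
theorem normCutoff_nonneg (R : ℝ) (u : H) : 0 ≤ normCutoff R u := le_max_left _ _

omit [NormedSpace ℝ H] in
theorem normCutoff_le_one (R : ℝ) (u : H) : normCutoff R u ≤ 1 :=
  max_le zero_le_one (min_le_left _ _)

omit [NormedSpace ℝ H] in
theorem normCutoff_eq_one {R : ℝ} (hR : 0 < R) {u : H} (hu : ‖u‖ ≤ R) : normCutoff R u = 1 := by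
  have : ‖u‖ / R ≤ 1 := (div_le_one hR).2 hu
  rw [normCutoff, min_eq_left (by linarith), max_eq_right zero_le_one]

omit [NormedSpace ℝ H] in
theorem normCutoff_eq_zero {R : ℝ} (hR : 0 < R) {u : H} (hu : 2 * R ≤ ‖u‖) :
    normCutoff R u = 0 := by
  have : 2 ≤ ‖u‖ / R := (le_div_iff₀ hR).2 hu
  rw [normCutoff, max_eq_left]
  exact (min_le_right _ _).trans (by linarith)

omit [NormedSpace ℝ H] in
theorem abs_normCutoff_sub_le {R : ℝ} (hR : 0 < R) (u v : H) :
    |normCutoff R u - normCutoff R v| ≤ R⁻¹ * ‖u - v‖ := by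
  have h1 : |normCutoff R u - normCutoff R v| ≤ |‖u‖ / R - ‖v‖ / R| := by
    refine (abs_max_sub_max_le_max _ _ _ _).trans ?_
    refine max_le (by simp) ?_
    refine (abs_min_sub_min_le_max _ _ _ _).trans ?_
    refine max_le (by simp) ?_
    rw [show 2 - ‖u‖ / R - (2 - ‖v‖ / R) = -(‖u‖ / R - ‖v‖ / R) by ring, abs_neg]
  refine h1.trans ?_
  rw [← sub_div, abs_div, abs_of_pos hR, div_eq_inv_mul]
  exact mul_le_mul_of_nonneg_left (abs_norm_sub_norm_le u v) (inv_nonneg.2 hR.le)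

omit [NormedSpace ℝ H] in
theorem exists_lipschitzOnWith_bound (hL : ∀ R : ℝ, ∃ K, LipschitzOnWith K X (closedBall 0 R))
    {R : ℝ} (hR : 0 ≤ R) : ∃ L : NNReal, ∀ u : H, ‖u‖ ≤ R → ‖X u‖ ≤ L := by
  obtain ⟨K, hK⟩ := hL R
  refine ⟨NNReal.mk (‖X 0‖ + K * R) (by positivity), fun u hu => ?_⟩
  have h := hK.norm_sub_le (x := u) (y := 0) (by simpa using hu) (by simpa using hR)
  rw [sub_zero] at h
  have h1 : ‖X u‖ ≤ ‖X 0‖ + ‖X u - X 0‖ := by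
    simpa using norm_add_le (X 0) (X u - X 0)
  have h2 : (K : ℝ) * ‖u‖ ≤ K * R := by gcongr
  change ‖X u‖ ≤ ‖X 0‖ + K * R
  linarith

/-- A vector field that is Lipschitz on balls and tangent to the spheres has integral curves on
arbitrarily long time intervals. -/
theorem exists_curve_Icc [CompleteSpace H]
    (hN : ∀ u : H, HasFDerivAt (fun v : H => ‖v‖ ^ 2) (N u) u)
    (hX : ∀ u, N u (X u) = 0) (hL : ∀ R : ℝ, ∃ K, LipschitzOnWith K X (closedBall 0 R))
    (x : H) {T : ℝ} (hT : 0 < T) :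
    ∃ γ : ℝ → H, γ 0 = x ∧ ∀ t ∈ Icc (-T) T, HasDerivWithinAt γ (X (γ t)) (Icc (-T) T) t := by
  set R : ℝ := ‖x‖ + 1
  have hR : 0 < R := by positivity
  -- The truncated field vanishes outside the ball of radius `2 * R`, so `L` bounds it everywhere.
  -- Picard-Lindelöf on a ball of radius `L * T` then covers the whole interval, however long.
  obtain ⟨L, hLb⟩ := exists_lipschitzOnWith_bound hL (R := 2 * R) (by positivity)
  have hbound : ∀ u, ‖normCutoff R u • X u‖ ≤ L := by
    intro u
    rw [norm_smul, Real.norm_of_nonneg (normCutoff_nonneg _ _)]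
    rcases le_total ‖u‖ (2 * R) with hu | hu
    · calc normCutoff R u * ‖X u‖ ≤ 1 * L := by
            gcongr
            · exact normCutoff_le_one _ _
            · exact hLb u hu
        _ = L := one_mul _
    · rw [normCutoff_eq_zero hR hu, zero_mul]; exact L.2
  set a : NNReal := NNReal.mk (L * T) (by positivity)
  obtain ⟨K, hK⟩ := hL (‖x‖ + a)
  obtain ⟨L', hL'⟩ := exists_lipschitzOnWith_bound hL (R := ‖x‖ + a) (by positivity)
  have hsub : closedBall x a ⊆ closedBall 0 (‖x‖ + a) := by
    intro u hu
    rw [mem_closedBall_iff_norm] at hu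
    rw [mem_closedBall_zero_iff]
    calc ‖u‖ = ‖x + (u - x)‖ := by simp
      _ ≤ ‖x‖ + ‖u - x‖ := norm_add_le _ _
      _ ≤ _ := by gcongr
  have hLip : LipschitzOnWith (K + NNReal.mk R⁻¹ (by positivity) * L')
      (fun u => normCutoff R u • X u) (closedBall x a) := by
    refine LipschitzOnWith.of_dist_le_mul fun u hu v hv => ?_
    rw [dist_eq_norm, dist_eq_norm]
    have e : normCutoff R u • X u - normCutoff R v • X v =
        normCutoff R u • (X u - X v) + (normCutoff R u - normCutoff R v) • X v := by
      rw [smul_sub, sub_smul]; abel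
    rw [e]
    have h1 := hK.norm_sub_le (hsub hu) (hsub hv)
    have h2 := hL' v (by simpa using hsub hv)
    refine (norm_add_le _ _).trans ?_
    rw [norm_smul, norm_smul, Real.norm_of_nonneg (normCutoff_nonneg _ _), Real.norm_eq_abs]
    have h3 := abs_normCutoff_sub_le hR u v
    calc normCutoff R u * ‖X u - X v‖ + |normCutoff R u - normCutoff R v| * ‖X v‖
        ≤ 1 * (K * ‖u - v‖) + R⁻¹ * ‖u - v‖ * L' := by
          gcongr
          exact normCutoff_le_one _ _
      _ = _ := by push_cast [NNReal.coe_mk]; ring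
  have h0 : (0 : ℝ) ∈ Icc (-T) T := ⟨by linarith, hT.le⟩
  have hPL : IsPicardLindelof (fun _ u => normCutoff R u • X u) (tmin := -T) (tmax := T)
      ⟨0, h0⟩ x a 0 L (K + NNReal.mk R⁻¹ (by positivity) * L') :=
    { lipschitzOnWith := fun _ _ => hLip
      continuousOn := fun _ _ => continuousOn_const
      norm_le := fun _ _ u _ => hbound u
      mul_max_le := by simp [a] }
  obtain ⟨γ, hγ0, hγ⟩ := hPL.exists_eq_forall_mem_Icc_hasDerivWithinAt₀
  refine ⟨γ, hγ0, fun t ht => ?_⟩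
  -- The truncated field is a scalar multiple of `X`, hence still tangent to the spheres. The curve
  -- keeps the norm of `x`, below `R`, where the cutoff is `1`.
  have hn : ‖γ t‖ = ‖γ 0‖ := norm_eq_of_tangent hN hX (convex_Icc _ _) hγ ht h0
  have := hγ t ht
  rwa [normCutoff_eq_one hR (by rw [hn, hγ0]; linarith), one_smul] at this

theorem norm_eq_of_curve (hN : ∀ u : H, HasFDerivAt (fun v : H => ‖v‖ ^ 2) (N u) u)
    (hX : ∀ u, N u (X u) = 0) {γ : ℝ → H} (hγ : ∀ t, HasDerivAt γ (X (γ t)) t) (a b : ℝ) :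
    ‖γ a‖ = ‖γ b‖ :=
  norm_eq_of_tangent hN hX (c := fun _ => 1) convex_univ
    (fun t _ => by simpa using hγ t) (mem_univ a) (mem_univ b)

/-- Conservation of the norm confines both curves to one ball, on which the field has a single
Lipschitz constant, so Grönwall uniqueness applies for all times. -/
theorem curve_unique (hN : ∀ u : H, HasFDerivAt (fun v : H => ‖v‖ ^ 2) (N u) u)
    (hX : ∀ u, N u (X u) = 0) (hL : ∀ R : ℝ, ∃ K, LipschitzOnWith K X (closedBall 0 R))
    {γ δ : ℝ → H} (hγ : ∀ t, HasDerivAt γ (X (γ t)) t) (hδ : ∀ t, HasDerivAt δ (X (δ t)) t)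
    {t₀ : ℝ} (h : γ t₀ = δ t₀) : γ = δ := by
  obtain ⟨K, hK⟩ := hL ‖γ t₀‖
  refine ODE_solution_unique_univ (v := fun _ => X) (s := fun _ => closedBall 0 ‖γ t₀‖)
    (fun _ => hK) (fun t => ⟨hγ t, ?_⟩) (fun t => ⟨hδ t, ?_⟩) h
  · rw [mem_closedBall_zero_iff, norm_eq_of_curve hN hX hγ t t₀]
  · rw [mem_closedBall_zero_iff, norm_eq_of_curve hN hX hδ t t₀, h]

/-- A vector field that is Lipschitz on balls and tangent to the spheres is complete. -/
theorem exists_curve [CompleteSpace H]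
    (hN : ∀ u : H, HasFDerivAt (fun v : H => ‖v‖ ^ 2) (N u) u)
    (hX : ∀ u, N u (X u) = 0) (hL : ∀ R : ℝ, ∃ K, LipschitzOnWith K X (closedBall 0 R)) (x : H) :
    ∃ γ : ℝ → H, γ 0 = x ∧ ∀ t, HasDerivAt γ (X (γ t)) t := by
  choose γ hγ0 hγ using fun n : ℕ =>
    exists_curve_Icc hN hX hL x (T := (n : ℝ) + 1) (by positivity)
  have hder : ∀ (n : ℕ) (t : ℝ), t ∈ Ioo (-((n : ℝ) + 1)) (n + 1) →
      HasDerivAt (γ n) (X (γ n t)) t := fun n t ht =>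
    (hγ n t (Ioo_subset_Icc_self ht)).hasDerivAt (Icc_mem_nhds ht.1 ht.2)
  have h0 : ∀ n : ℕ, (0 : ℝ) ∈ Ioo (-((n : ℝ) + 1)) (n + 1) := fun n =>
    ⟨by linarith [n.cast_nonneg (α := ℝ)], by positivity⟩
  have hnorm : ∀ (n : ℕ) (t : ℝ), t ∈ Icc (-((n : ℝ) + 1)) (n + 1) → ‖γ n t‖ = ‖x‖ := by
    intro n t ht
    rw [← hγ0 n]
    refine norm_eq_of_tangent hN hX (c := fun _ => 1) (convex_Icc _ _) ?_ ht
      (Ioo_subset_Icc_self (h0 n))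
    intro t ht
    simpa using hγ n t ht
  obtain ⟨K, hK⟩ := hL ‖x‖
  have hcons : ∀ m n : ℕ, m ≤ n → EqOn (γ m) (γ n) (Ioo (-((m : ℝ) + 1)) (m + 1)) := by
    intro m n hmn
    have hmn' : (m : ℝ) ≤ n := by exact_mod_cast hmn
    have hsub : Ioo (-((m : ℝ) + 1)) (m + 1) ⊆ Ioo (-((n : ℝ) + 1)) (n + 1) :=
      Ioo_subset_Ioo (by linarith) (by linarith)
    refine ODE_solution_unique_of_mem_Ioo (v := fun _ => X) (s := fun _ => closedBall 0 ‖x‖)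
      (fun _ _ => hK) (h0 m) (fun t ht => ⟨hder m t ht, ?_⟩)
      (fun t ht => ⟨hder n t (hsub ht), ?_⟩) (by rw [hγ0, hγ0])
    · rw [mem_closedBall_zero_iff, hnorm m t (Ioo_subset_Icc_self ht)]
    · rw [mem_closedBall_zero_iff, hnorm n t (Ioo_subset_Icc_self (hsub ht))]
  have hmem : ∀ (n : ℕ) (t : ℝ), |t| < n + 1 → t ∈ Ioo (-((n : ℝ) + 1)) (n + 1) :=
    fun n t ht => abs_lt.1 ht
  have hfl : ∀ t : ℝ, |t| < ((⌊|t|⌋₊ : ℕ) : ℝ) + 1 := fun t => Nat.lt_floor_add_one _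
  have heq : ∀ (n : ℕ) (t : ℝ), t ∈ Ioo (-((n : ℝ) + 1)) (n + 1) →
      γ ⌊|t|⌋₊ t = γ n t := by
    intro n t ht
    rcases le_total ⌊|t|⌋₊ n with h | h
    · exact hcons _ _ h (hmem _ _ (hfl t))
    · exact (hcons _ _ h ht).symm
  -- The local solutions agree on overlaps, and the one of index `⌊|t|⌋₊` is defined on an open
  -- interval containing `t`.
  refine ⟨fun t => γ ⌊|t|⌋₊ t, hγ0 _, fun t => ?_⟩
  have ht := hmem _ _ (hfl t)
  refine (hder _ t ht).congr_of_eventuallyEq ?_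
  filter_upwards [Ioo_mem_nhds ht.1 ht.2] with s hs using heq _ s hs

/-- Lipschitz dependence of integral curves on the initial datum. -/
theorem exists_dist_curve_le (hN : ∀ u : H, HasFDerivAt (fun v : H => ‖v‖ ^ 2) (N u) u)
    (hX : ∀ u, N u (X u) = 0) (hL : ∀ R : ℝ, ∃ K, LipschitzOnWith K X (closedBall 0 R))
    (R t : ℝ) : ∃ C : NNReal, ∀ γ δ : ℝ → H, (∀ t, HasDerivAt γ (X (γ t)) t) →
      (∀ t, HasDerivAt δ (X (δ t)) t) → ‖γ 0‖ ≤ R → ‖δ 0‖ ≤ R →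
      dist (γ t) (δ t) ≤ C * dist (γ 0) (δ 0) := by
  obtain ⟨K, hK⟩ := hL R
  -- The field is quantified again because negative times are reached by applying the estimate to
  -- `-X` and the reversed curves.
  have key : ∀ (X : H → H), (∀ u, N u (X u) = 0) → LipschitzOnWith K X (closedBall 0 R) →
      ∀ t : ℝ, 0 ≤ t → ∀ γ δ : ℝ → H, (∀ t, HasDerivAt γ (X (γ t)) t) →
      (∀ t, HasDerivAt δ (X (δ t)) t) → ‖γ 0‖ ≤ R → ‖δ 0‖ ≤ R →
      dist (γ t) (δ t) ≤ dist (γ 0) (δ 0) * Real.exp (K * t) := by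
    intro X hX hK t ht γ δ hγ hδ h1 h2
    have := dist_le_of_trajectories_ODE_of_mem (v := fun _ => X) (f := γ) (g := δ) (K := K)
      (s := fun _ => closedBall 0 R) (a := 0) (b := t) (δ := dist (γ 0) (δ 0)) (fun _ _ => hK)
      (fun s _ => (hγ s).continuousAt.continuousWithinAt) (fun s _ => (hγ s).hasDerivWithinAt)
      (fun s _ => by rwa [mem_closedBall_zero_iff, norm_eq_of_curve hN hX hγ s 0])
      (fun s _ => (hδ s).continuousAt.continuousWithinAt) (fun s _ => (hδ s).hasDerivWithinAt)
      (fun s _ => by rwa [mem_closedBall_zero_iff, norm_eq_of_curve hN hX hδ s 0]) le_rfl t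
      ⟨ht, le_rfl⟩
    simpa using this
  refine ⟨NNReal.mk (Real.exp (K * |t|)) (Real.exp_pos _).le, fun γ δ hγ hδ h1 h2 => ?_⟩
  rw [mul_comm]
  rcases le_total 0 t with ht | ht
  · rw [NNReal.coe_mk, abs_of_nonneg ht]
    exact key X hX hK t ht γ δ hγ hδ h1 h2
  · have hrev : ∀ γ : ℝ → H, (∀ t, HasDerivAt γ (X (γ t)) t) →
        ∀ t, HasDerivAt (fun s => γ (-s)) (-X (γ (-t))) t := by
      intro γ hγ t
      have := (hγ (-t)).scomp t (hasDerivAt_neg t)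
      rwa [neg_one_smul] at this
    have := key (fun u => -X u) (fun u => by simp [hX]) hK.neg (-t) (by linarith)
      (fun s => γ (-s)) (fun s => δ (-s)) (hrev γ hγ) (hrev δ hδ) (by simpa using h1)
      (by simpa using h2)
    rw [NNReal.coe_mk, abs_of_nonpos ht]
    simpa using this

end ODE

/-! ### Liouville's theorem for locally Lipschitz, norm-preserving flows -/

section Liouville

open Set Metric Module

variable {F : Type*} [NormedAddCommGroup F] [NormedSpace ℝ F] [FiniteDimensional ℝ F]
  [MeasurableSpace F] [BorelSpace F] (μ : Measure F)

omit [NormedSpace ℝ F] [FiniteDimensional ℝ F] [MeasurableSpace F] [BorelSpace F] in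
theorem exists_support_subset_closedBall {φ : F → ℝ} (hφ : HasCompactSupport φ) :
    ∃ R : ℝ, 0 ≤ R ∧ ∀ u, R < ‖u‖ → φ u = 0 := by
  obtain ⟨R, hR⟩ := hφ.isCompact.isBounded.subset_closedBall 0
  refine ⟨max R 0, le_max_right _ _, fun u hu => ?_⟩
  by_contra h
  have := hR (subset_tsupport φ h)
  rw [mem_closedBall_zero_iff] at this
  exact absurd this (not_le.2 ((le_max_left _ _).trans_lt hu))

/-- The integral of the derivative of a compactly supported Lipschitz function along a
divergence-free vector field vanishes. -/
theorem integral_fderiv_apply_eq_zero [μ.IsAddHaarMeasure] {X : F → F} (hX : ContDiff ℝ 1 X)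
    {ι : Type*} [Fintype ι] (b : Basis ι ℝ F)
    (hdiv : ∀ u, ∑ i, b.coord i (fderiv ℝ X u (b i)) = 0)
    {φ : F → ℝ} {C : NNReal} (hφ : LipschitzWith C φ) (hc : HasCompactSupport φ) :
    ∫ u, fderiv ℝ φ u (X u) ∂μ = 0 := by
  obtain ⟨R, hR0, hR⟩ := exists_support_subset_closedBall hc
  -- Integration by parts needs compactly supported components. Since `χ` is `1` on a full
  -- neighbourhood of the ball carrying `φ`, neither `X` nor its derivative is altered there.
  let χ : ContDiffBump (0 : F) := ⟨R + 1, R + 2, by linarith, by linarith⟩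
  let ℓ : ι → F →L[ℝ] ℝ := fun i => LinearMap.toContinuousLinearMap (b.coord i)
  have hℓ : ∀ i u, ℓ i u = b.coord i u := fun i u => rfl
  let Y : ι → F → ℝ := fun i u => χ u * ℓ i (X u)
  have hY : ∀ i, ContDiff ℝ 1 (Y i) := fun i =>
    χ.contDiff.mul ((ℓ i).contDiff.comp hX)
  have hYc : ∀ i, HasCompactSupport (Y i) := fun i => χ.hasCompactSupport.mul_right
  choose D hD using fun i => (hY i).lipschitzWith_of_hasCompactSupport (hYc i) one_ne_zero
  have hχ : ∀ u, ‖u‖ ≤ R + 1 → χ u = 1 := fun u hu =>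
    χ.one_of_mem_closedBall (by simpa using hu)
  have hibp : ∀ i, ∫ u, lineDeriv ℝ φ u (b i) * Y i u ∂μ =
      ∫ u, lineDeriv ℝ (Y i) u (-b i) * φ u ∂μ := fun i =>
    LipschitzWith.integral_lineDeriv_mul_eq hφ (hD i) (hYc i) (b i)
  have h1 : ∫ u, fderiv ℝ φ u (X u) ∂μ = ∫ u, ∑ i, lineDeriv ℝ φ u (b i) * Y i u ∂μ := by
    refine integral_congr_ae ?_
    filter_upwards [hφ.ae_differentiableAt (μ := μ)] with u hu
    simp_rw [hu.lineDeriv_eq_fderiv]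
    rcases le_or_gt ‖u‖ R with h | h
    · have : X u = ∑ i, ℓ i (X u) • b i := by
        simp [hℓ]
      conv_lhs => rw [this]
      rw [map_sum]
      refine Finset.sum_congr rfl fun i _ => ?_
      simp only [Y]
      rw [hχ u (by linarith), one_mul, map_smul, smul_eq_mul, mul_comm]
    · have : φ =ᶠ[𝓝 u] fun _ => 0 := by
        filter_upwards [(isOpen_lt continuous_const continuous_norm).mem_nhds h] with v hv
        exact hR v hv
      rw [this.fderiv_eq]
      simp
  have h2 : ∀ i ∈ Finset.univ, Integrable (fun u => lineDeriv ℝ φ u (b i) * Y i u) μ := by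
    intro i _
    have hYi : Integrable (Y i) μ := (hY i).continuous.integrable_of_hasCompactSupport (hYc i)
    exact (hφ.memLp_lineDeriv (b i)).integrable_mul (memLp_one_iff_integrable.2 hYi)
  have h3 : ∀ i ∈ Finset.univ, Integrable (fun u => lineDeriv ℝ (Y i) u (-b i) * φ u) μ := by
    intro i _
    have hφi : Integrable φ μ := hφ.continuous.integrable_of_hasCompactSupport hc
    exact ((hD i).memLp_lineDeriv (-b i)).integrable_mul (memLp_one_iff_integrable.2 hφi)
  rw [h1, integral_finsetSum _ h2]
  simp_rw [hibp]
  rw [← integral_finsetSum _ h3]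
  refine integral_eq_zero_of_ae (Eventually.of_forall fun u => ?_)
  rcases le_or_gt ‖u‖ R with h | h
  · have hder : ∀ i, lineDeriv ℝ (Y i) u (-b i) = -b.coord i (fderiv ℝ X u (b i)) := by
      intro i
      rw [((hY i).differentiable one_ne_zero u).lineDeriv_eq_fderiv]
      have : Y i =ᶠ[𝓝 u] fun v => ℓ i (X v) := by
        have ho : ‖u‖ < R + 1 := by linarith
        filter_upwards [(isOpen_lt continuous_norm continuous_const).mem_nhds ho] with v hv
        simp only [Y]
        rw [hχ v (le_of_lt hv), one_mul]
      have e := ((ℓ i).hasFDerivAt.comp u (hX.differentiable one_ne_zero u).hasFDerivAt).fderiv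
      rw [this.fderiv_eq, map_neg]
      change -(fderiv ℝ (ℓ i ∘ X) u) (b i) = _
      rw [e]
      simp [hℓ]
    simp_rw [hder]
    rw [← Finset.sum_mul, Finset.sum_neg_distrib, hdiv, neg_zero, zero_mul]
    rfl
  · simp [hR u h]

/-- Thickened indicators are Lipschitz test functions converging to the indicator of `K`; the
indicator of the closed `1`-thickening, which is compact, dominates them. Thus Lipschitz test
functions determine the measure of compact sets. -/
theorem tendsto_integral_thickenedIndicator (ν : Measure F) [IsFiniteMeasureOnCompacts ν]
    {K : Set F} (hK : IsCompact K) {δ : ℕ → ℝ} (hδ : ∀ n, 0 < δ n) (hδ1 : ∀ n, δ n ≤ 1)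
    (hδ0 : Tendsto δ atTop (𝓝 0)) :
    Tendsto (fun n => ∫ u, (thickenedIndicator (hδ n) K u : ℝ) ∂ν) atTop (𝓝 (ν.real K)) := by
  have e : ν.real K = ∫ u, K.indicator (fun _ => (1 : ℝ)) u ∂ν := by
    rw [integral_indicator hK.measurableSet]
    simp
  rw [e]
  have hT : IsCompact (cthickening 1 K) := hK.cthickening
  refine tendsto_integral_of_dominated_convergence
    ((cthickening 1 K).indicator (fun _ => (1 : ℝ))) ?_ ?_ ?_ ?_
  · intro n
    exact (NNReal.continuous_coe.comp (thickenedIndicator (hδ n) K).continuous).aestronglyMeasurable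
  · exact (integrable_indicator_iff hT.measurableSet).2 (integrableOn_const hT.measure_lt_top.ne)
  · intro n
    refine Eventually.of_forall fun u => ?_
    by_cases hu : u ∈ cthickening 1 K
    · rw [indicator_of_mem hu]
      simpa using thickenedIndicator_le_one (hδ n) K u
    · rw [indicator_of_notMem hu, thickenedIndicator_zero (hδ n) K]
      · simp
      · exact fun h => hu (thickening_subset_cthickening_of_le (hδ1 n) K h)
  · refine Eventually.of_forall fun u => ?_
    have h := (tendsto_pi_nhds.1 (thickenedIndicator_tendsto_indicator_closure hδ hδ0 K)) u
    rw [hK.isClosed.closure_eq] at h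
    have h2 := (NNReal.continuous_coe.tendsto _).comp h
    have e' : K.indicator (fun _ => (1 : ℝ)) u =
        ((K.indicator (fun _ => (1 : NNReal)) u : NNReal) : ℝ) := by
      by_cases hu : u ∈ K <;> simp [hu]
    rw [e']
    exact h2

/-- **Liouville's theorem**: a norm-preserving flow generated by a divergence-free vector field
preserves the Haar measure. -/
theorem measurePreserving_of_divergence_eq_zero [μ.IsAddHaarMeasure] {X : F → F}
    (hX : ContDiff ℝ 1 X) {ι : Type*} [Fintype ι] (b : Basis ι ℝ F)
    (hdiv : ∀ u, ∑ i, b.coord i (fderiv ℝ X u (b i)) = 0) {Ψ : ℝ → F → F}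
    (h0 : ∀ u, Ψ 0 u = u) (hadd : ∀ s t u, Ψ (s + t) u = Ψ s (Ψ t u))
    (hder : ∀ u t, HasDerivAt (fun s => Ψ s u) (X (Ψ t u)) t)
    (hnorm : ∀ t u, ‖Ψ t u‖ = ‖u‖)
    (hLip : ∀ t R : ℝ, ∃ C : NNReal, LipschitzOnWith C (Ψ t) (closedBall 0 R)) (t : ℝ) :
    MeasurePreserving (Ψ t) μ μ := by
  have hcont : ∀ t, Continuous (Ψ t) := by
    intro t
    refine continuous_iff_continuousAt.2 fun u => ?_
    obtain ⟨C, hC⟩ := hLip t (‖u‖ + 1)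
    refine hC.continuousOn.continuousAt (Filter.mem_of_superset
      ((isOpen_lt continuous_norm continuous_const).mem_nhds (lt_add_one ‖u‖)) ?_)
    intro v hv
    rw [mem_closedBall_zero_iff]
    exact le_of_lt hv
  have hsupp : ∀ (t : ℝ) (φ : F → ℝ) (R : ℝ), (∀ u, R < ‖u‖ → φ u = 0) →
      ∀ u, R < ‖u‖ → φ (Ψ t u) = 0 := fun t φ R h u hu => h _ (by rwa [hnorm])
  have hcs : ∀ (t : ℝ) (φ : F → ℝ), HasCompactSupport φ →
      HasCompactSupport (fun u => φ (Ψ t u)) := by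
    intro t φ hφ
    obtain ⟨R, -, hR⟩ := exists_support_subset_closedBall hφ
    refine HasCompactSupport.intro (isCompact_closedBall (0 : F) R) fun u hu => ?_
    exact hsupp t φ R hR u (by simpa using hu)
  -- Nearby points lie in a ball where `Ψ t` is Lipschitz. If one point is in the support ball and
  -- the other outside the ball of radius `R + 1`, their distance is at least `1` and the sup bound
  -- `M` suffices.
  have hlipc : ∀ (t : ℝ) (φ : F → ℝ) (C : NNReal), LipschitzWith C φ → HasCompactSupport φ →
      ∃ C' : NNReal, LipschitzWith C' (fun u => φ (Ψ t u)) := by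
    intro t φ C hφ hφc
    obtain ⟨R, hR0, hR⟩ := exists_support_subset_closedBall hφc
    obtain ⟨K, hK⟩ := hLip t (R + 1)
    obtain ⟨M, hM⟩ := hφc.exists_bound_of_continuous hφ.continuous
    have hM0 : 0 ≤ M := (norm_nonneg _).trans (hM 0)
    refine ⟨C * K + NNReal.mk M hM0, LipschitzWith.of_dist_le_mul ?_⟩
    have main : ∀ u v : F, ‖u‖ ≤ R →
        dist (φ (Ψ t u)) (φ (Ψ t v)) ≤ (C * K + M) * dist u v := by
      intro u v hu
      rcases le_or_gt ‖v‖ (R + 1) with hv | hv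
      · calc dist (φ (Ψ t u)) (φ (Ψ t v)) ≤ C * dist (Ψ t u) (Ψ t v) := hφ.dist_le_mul _ _
          _ ≤ C * (K * dist u v) := by
            gcongr
            exact hK.dist_le_mul u (by simp; linarith) v (by simpa using hv)
          _ ≤ (C * K + M) * dist u v := by
            rw [add_mul, mul_assoc]
            exact le_add_of_nonneg_right (by positivity)
      · have h1 : 1 ≤ dist u v := by
          have := norm_sub_norm_le v u
          rw [dist_comm, dist_eq_norm]
          linarith
        rw [hsupp t φ R hR v (by linarith), dist_zero_right]
        calc ‖φ (Ψ t u)‖ ≤ M := hM _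
          _ ≤ M * dist u v := le_mul_of_one_le_right hM0 h1
          _ ≤ (C * K + M) * dist u v := by
            gcongr
            exact le_add_of_nonneg_left (by positivity)
    intro u v
    change _ ≤ ((C * K : NNReal) + M) * dist u v
    push_cast
    rcases le_or_gt ‖u‖ R with hu | hu
    · exact main u v hu
    rcases le_or_gt ‖v‖ R with hv | hv
    · rw [dist_comm, dist_comm u v]
      exact main v u hv
    · rw [hsupp t φ R hR u hu, hsupp t φ R hR v hv, dist_self]
      positivity
  have hder0 : ∀ (φ : F → ℝ) (C : NNReal), LipschitzWith C φ → HasCompactSupport φ →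
      HasDerivAt (fun h => ∫ u, φ (Ψ h u) ∂μ) 0 0 := by
    intro φ C hφ hφc
    obtain ⟨R, hR0, hR⟩ := exists_support_subset_closedBall hφc
    obtain ⟨L, hL⟩ : ∃ L : ℝ, ∀ u ∈ closedBall (0 : F) R, ‖X u‖ ≤ L :=
      (isCompact_closedBall (0 : F) R).exists_bound_of_continuousOn hX.continuous.continuousOn
    have hL0 : 0 ≤ L := (norm_nonneg _).trans (hL 0 (by simpa using hR0))
    have key := (hasDerivAt_integral_of_dominated_loc_of_lip (𝕜 := ℝ) (μ := μ)
      (F := fun h u => φ (Ψ h u)) (x₀ := (0 : ℝ)) (s := univ)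
      (F' := fun u => fderiv ℝ φ u (X u))
      (bound := (closedBall (0 : F) R).indicator (fun _ => (C : ℝ) * L)) univ_mem
      (Eventually.of_forall fun h => (hφ.continuous.comp (hcont h)).aestronglyMeasurable)
      ((hφ.continuous.comp (hcont 0)).integrable_of_hasCompactSupport (hcs 0 φ hφc))
      ?_ ?_ ?_ ?_).2
    · rwa [integral_fderiv_apply_eq_zero μ hX b hdiv hφ hφc] at key
    · have hm : Measurable (fderiv ℝ φ) := measurable_fderiv ℝ φ
      exact (isBoundedBilinearMap_apply (𝕜 := ℝ) (E := F) (F := ℝ)).continuous.comp_aestronglyMeasurable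
        (hm.aestronglyMeasurable.prodMk hX.continuous.aestronglyMeasurable)
    · refine Eventually.of_forall fun u => ?_
      by_cases hu : u ∈ closedBall (0 : F) R
      · rw [indicator_of_mem hu]
        have hl : LipschitzWith (NNReal.mk L hL0) (fun h => Ψ h u) := by
          refine lipschitzWith_of_nnnorm_deriv_le (fun t => (hder u t).differentiableAt) fun t => ?_
          rw [(hder u t).deriv, ← NNReal.coe_le_coe]
          exact hL _ (by simpa [hnorm] using hu)
        have := (hφ.comp hl).lipschitzOnWith (s := univ)
        refine this.weaken (le_of_eq ?_)
        ext
        simp [abs_of_nonneg hL0]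
      · have hu' : R < ‖u‖ := by simpa using hu
        have : (fun h => φ (Ψ h u)) = fun _ => 0 := funext fun h => hsupp h φ R hR u hu'
        rw [this]
        exact ((LipschitzWith.const (0 : ℝ)).weaken zero_le).lipschitzOnWith
    · exact (integrable_indicator_iff measurableSet_closedBall).2
        (integrableOn_const measure_closedBall_lt_top.ne)
    -- Rademacher's theorem: only `φ` must be differentiable, and only at the starting point,
    -- because `Ψ 0` is the identity.
    · filter_upwards [hφ.ae_differentiableAt (μ := μ)] with u hu
      have h1 : HasDerivAt (fun s => Ψ s u) (X u) 0 := by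
        simpa [h0] using hder u 0
      exact HasFDerivAt.comp_hasDerivAt (0 : ℝ)
        (by rw [h0]; exact hu.hasFDerivAt) h1
  have hconst : ∀ (φ : F → ℝ) (C : NNReal), LipschitzWith C φ → HasCompactSupport φ →
      ∀ t, ∫ u, φ (Ψ t u) ∂μ = ∫ u, φ u ∂μ := by
    intro φ C hφ hφc t
    have hd : ∀ t, HasDerivAt (fun h => ∫ u, φ (Ψ h u) ∂μ) 0 t := by
      intro t
      obtain ⟨C', hC'⟩ := hlipc t φ C hφ hφc
      have h1 := hder0 _ C' hC' (hcs t φ hφc)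
      -- The group law turns the derivative at time `t` into the derivative at time `0` for the test
      -- function `φ ∘ Ψ t`, which is again Lipschitz with compact support.
      have h2 : HasDerivAt (fun h => ∫ u, φ (Ψ (t + (h - t)) u) ∂μ) 0 t := by
        simp_rw [hadd]
        have h3 : HasDerivAt (fun h : ℝ => h - t) 1 t := (hasDerivAt_id t).sub_const t
        have h4 : HasDerivAt (fun h => ∫ u, φ (Ψ t (Ψ h u)) ∂μ) 0 (t - t) := by
          rwa [sub_self]
        simpa [Function.comp_def] using HasDerivAt.comp (h := fun h : ℝ => h - t) t h4 h3
      simpa using h2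
    have := is_const_of_deriv_eq_zero (fun t => (hd t).differentiableAt) (fun t => (hd t).deriv) t 0
    simpa [h0] using this
  refine ⟨(hcont t).measurable, ?_⟩
  set ν := μ.map (Ψ t)
  have hν : IsFiniteMeasureOnCompacts ν := by
    refine ⟨fun K hK => ?_⟩
    obtain ⟨R, hR⟩ := hK.isBounded.subset_closedBall 0
    calc ν K ≤ ν (closedBall 0 R) := measure_mono hR
      _ = μ (closedBall 0 R) := by
        rw [Measure.map_apply (hcont t).measurable measurableSet_closedBall]
        congr 1
        ext u
        simp [hnorm]
      _ < _ := measure_closedBall_lt_top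
  have hcomp : ∀ K : Set F, IsCompact K → ν K = μ K := by
    intro K hK
    have hδ : ∀ n : ℕ, (0 : ℝ) < 1 / (n + 1) := fun n => by positivity
    have hδ1 : ∀ n : ℕ, (1 : ℝ) / (n + 1) ≤ 1 := fun n => by
      rw [div_le_one (by positivity)]; linarith [n.cast_nonneg (α := ℝ)]
    have hδ0 : Tendsto (fun n : ℕ => (1 : ℝ) / (n + 1)) atTop (𝓝 0) :=
      tendsto_one_div_add_atTop_nhds_zero_nat
    have A := tendsto_integral_thickenedIndicator ν hK hδ hδ1 hδ0
    have B := tendsto_integral_thickenedIndicator μ hK hδ hδ1 hδ0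
    have heq : ∀ n, ∫ u, (thickenedIndicator (hδ n) K u : ℝ) ∂ν =
        ∫ u, (thickenedIndicator (hδ n) K u : ℝ) ∂μ := by
      intro n
      have hl : LipschitzWith (NNReal.mk (1 / ((n : ℝ) + 1)) (hδ n).le)⁻¹
          (fun u => (thickenedIndicator (hδ n) K u : ℝ)) := by
        have h1 := lipschitzWith_thickenedIndicator (hδ n) K
        have h2 : LipschitzWith 1 ((↑) : NNReal → ℝ) := LipschitzWith.of_dist_le_mul fun x y => by
          simp [NNReal.dist_eq, Real.dist_eq]
        refine (h2.comp h1).weaken ?_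
        rw [one_mul]
        refine le_of_eq ?_
        congr 1
        ext
        simp only [one_div, Real.coe_toNNReal', NNReal.coe_mk]
        exact max_eq_left (by positivity)
      have hc : HasCompactSupport (fun u => (thickenedIndicator (hδ n) K u : ℝ)) := by
        refine HasCompactSupport.intro hK.cthickening (K := cthickening 1 K) fun u hu => ?_
        rw [thickenedIndicator_zero (hδ n) K]
        · simp
        · exact fun h => hu (thickening_subset_cthickening_of_le (hδ1 n) K h)
      rw [integral_map (hcont t).measurable.aemeasurable hl.continuous.aestronglyMeasurable]
      exact hconst _ _ hl hc t
    have hr : ν.real K = μ.real K := tendsto_nhds_unique A (by simpa only [heq] using B)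
    exact (measureReal_eq_measureReal_iff hK.measure_lt_top.ne hK.measure_lt_top.ne).1 hr
  refine Measure.OuterRegular.ext_isOpen fun U hU => ?_
  rw [hU.measure_eq_iSup_isCompact, hU.measure_eq_iSup_isCompact]
  exact iSup_congr fun K => iSup_congr fun _ => iSup_congr fun hK => hcomp K hK

end Liouville

/-! ### `L²` bound for the trilinear operator -/

section Kernel

open scoped ENNReal

/-- The similarity `x ↦ c x + l x^⊥` of the plane. -/
def similarity (c l : ℝ) : Plane →ₗ[ℝ] Plane := Matrix.toEuclideanLin !![c, -l; l, c]

theorem similarity_apply (c l : ℝ) (x : Plane) : similarity c l x = c • x + l • perp x := by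
  ext i
  fin_cases i <;>
    simp [similarity, perp, Matrix.toLpLin_apply, dotProduct, Fin.sum_univ_two, add_comm]

theorem det_similarity (c l : ℝ) : LinearMap.det (similarity c l) = c ^ 2 + l ^ 2 := by
  have : similarity c l = Matrix.toLin (EuclideanSpace.basisFun (Fin 2) ℝ).toBasis
      (EuclideanSpace.basisFun (Fin 2) ℝ).toBasis !![c, -l; l, c] := by
    rw [similarity, Matrix.toEuclideanLin_eq_toLin_orthonormal]
  rw [this, LinearMap.det_toLin, Matrix.det_fin_two_of]
  ring

theorem measurable_perp : Measurable perp := by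
  have : perp = similarity 0 1 := funext fun x => by simp [similarity_apply]
  rw [this]
  exact (LinearMap.continuous_of_finiteDimensional _).measurable

@[fun_prop]
theorem continuous_perp : Continuous perp := by
  have : perp = similarity 0 1 := funext fun x => by simp [similarity_apply]
  rw [this]
  exact LinearMap.continuous_of_finiteDimensional _

theorem perp_neg (x : Plane) : perp (-x) = -perp x := by
  ext i; fin_cases i <;> simp [perp]

theorem map_similarity {c l : ℝ} (h : c ^ 2 + l ^ 2 ≠ 0) :
    Measure.map (similarity c l) (volume : Measure Plane) =
      ENNReal.ofReal (c ^ 2 + l ^ 2)⁻¹ • volume := by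
  rw [Measure.map_linearMap_addHaar_eq_smul_addHaar _ (by rwa [det_similarity]), det_similarity,
    abs_of_nonneg (by positivity)]

theorem quasiMeasurePreserving_similarity_add {c l : ℝ} (h : c ^ 2 + l ^ 2 ≠ 0) (z : Plane) :
    Measure.QuasiMeasurePreserving (fun x => c • x + l • perp x + z) (volume : Measure Plane)
      volume := by
  have h1 : Measure.QuasiMeasurePreserving (similarity c l) (volume : Measure Plane) volume := by
    refine ⟨(LinearMap.continuous_of_finiteDimensional _).measurable, ?_⟩
    rw [map_similarity h]
    exact Measure.smul_absolutelyContinuous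
  have := (measurePreserving_add_right (volume : Measure Plane) z).quasiMeasurePreserving.comp h1
  simpa only [Function.comp_def, similarity_apply] using this

theorem lintegral_similarity_add {c l : ℝ} (h : c ^ 2 + l ^ 2 ≠ 0) (z : Plane)
    {g : Plane → ℝ≥0∞} (hg : Measurable g) :
    ∫⁻ x, g (c • x + l • perp x + z) = ENNReal.ofReal (c ^ 2 + l ^ 2)⁻¹ * ∫⁻ x, g x := by
  have h1 : ∫⁻ x, g (c • x + l • perp x + z) =
      ∫⁻ y, g (y + z) ∂(Measure.map (similarity c l) volume) := by
    rw [lintegral_map (by fun_prop) (LinearMap.continuous_of_finiteDimensional _).measurable]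
    simp only [similarity_apply]
  rw [h1, map_similarity h, lintegral_smul_measure, lintegral_add_right_eq_self, smul_eq_mul]

/-- Translating `z` by `-x` frees the first factor from `x`. The second then depends on `x` through
`x ↦ -x + l x^⊥`, a similarity of determinant `1 + l²`. -/
theorem lintegral_lintegral_corner (l : ℝ) {g h : Plane → ℝ≥0∞} (hg : Measurable g)
    (hh : Measurable h) :
    ∫⁻ x, ∫⁻ z, g (x + z) * h (l • perp x + z) =
      ENNReal.ofReal (1 + l ^ 2)⁻¹ * ((∫⁻ x, g x) * ∫⁻ x, h x) := by
  have h1 : ∀ x : Plane, ∫⁻ z, g (x + z) * h (l • perp x + z) =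
      ∫⁻ z, g z * h ((-1 : ℝ) • x + l • perp x + z) := by
    intro x
    rw [← lintegral_add_left_eq_self (fun z => g z * h ((-1 : ℝ) • x + l • perp x + z)) x]
    refine lintegral_congr fun z => ?_
    congr 2
    rw [neg_one_smul]
    abel
  have hp := measurable_perp
  simp_rw [h1]
  rw [lintegral_lintegral_swap (by
    refine Measurable.aemeasurable ?_
    simp only [Function.uncurry_def]
    fun_prop)]
  have hne : (-1 : ℝ) ^ 2 + l ^ 2 ≠ 0 := by positivity
  have h2 : ∀ z : Plane, ∫⁻ x, g z * h ((-1 : ℝ) • x + l • perp x + z) =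
      g z * (ENNReal.ofReal (1 + l ^ 2)⁻¹ * ∫⁻ x, h x) := by
    intro z
    rw [lintegral_const_mul _ (by fun_prop), lintegral_similarity_add hne z hh]
    norm_num
  simp_rw [h2]
  rw [lintegral_mul_const _ hg]
  ring

theorem sq_lintegral_mul_le {α : Type*} [MeasurableSpace α] (μ : Measure α) {f g : α → ℝ≥0∞}
    (hf : Measurable f) (hg : Measurable g) :
    (∫⁻ a, f a * g a ∂μ) ^ 2 ≤ (∫⁻ a, f a ^ 2 ∂μ) * ∫⁻ a, g a ^ 2 ∂μ := by
  have h := ENNReal.lintegral_mul_le_Lp_mul_Lq μ Real.HolderConjugate.two_two hf.aemeasurable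
    hg.aemeasurable
  have h2 := pow_le_pow_left₀ zero_le h 2
  refine h2.trans (le_of_eq ?_)
  rw [mul_pow, ← ENNReal.rpow_natCast, ← ENNReal.rpow_mul, ← ENNReal.rpow_natCast,
    ← ENNReal.rpow_mul]
  norm_num

theorem lintegral_inv_one_add_sq :
    ∫⁻ l : ℝ, ENNReal.ofReal (1 + l ^ 2)⁻¹ = ENNReal.ofReal Real.pi := by
  rw [← integral_univ_inv_one_add_sq, ofReal_integral_eq_lintegral_ofReal
    integrable_inv_one_add_sq (Eventually.of_forall fun x => by positivity)]

/-- The integrand of the trilinear operator. -/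
def crKernel (f₁ f₂ f₃ : Plane → ℂ) (z : Plane) (p : ℝ × Plane) : ℂ :=
  f₁ (p.2 + z) * f₂ (p.1 • perp p.2 + z) * (starRingEnd ℂ) (f₃ (p.2 + p.1 • perp p.2 + z))

theorem crT_eq (f₁ f₂ f₃ : Plane → ℂ) (z : Plane) :
    crT f₁ f₂ f₃ z = ∫ l : ℝ, ∫ x : Plane, crKernel f₁ f₂ f₃ z (l, x) := rfl

variable {f₁ f₂ f₃ f₄ : Plane → ℂ}

theorem measurable_uncurry_crKernel (h₁ : Measurable f₁) (h₂ : Measurable f₂)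
    (h₃ : Measurable f₃) : Measurable (Function.uncurry (crKernel f₁ f₂ f₃)) := by
  have hp := measurable_perp
  have hc : Measurable (starRingEnd ℂ) := Complex.continuous_conj.measurable
  simp only [Function.uncurry_def, crKernel]
  fun_prop

theorem measurable_crKernel (h₁ : Measurable f₁) (h₂ : Measurable f₂)
    (h₃ : Measurable f₃) (z : Plane) : Measurable (crKernel f₁ f₂ f₃ z) :=
  Measurable.of_uncurry_left (measurable_uncurry_crKernel h₁ h₂ h₃)

theorem stronglyMeasurable_crT (h₁ : Measurable f₁) (h₂ : Measurable f₂)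
    (h₃ : Measurable f₃) : StronglyMeasurable (crT f₁ f₂ f₃) := by
  have h := (measurable_uncurry_crKernel h₁ h₂ h₃).stronglyMeasurable
  have h' : StronglyMeasurable (Function.uncurry fun (q : Plane × ℝ) (x : Plane) =>
      crKernel f₁ f₂ f₃ q.1 (q.2, x)) :=
    h.comp_measurable (g := fun r : (Plane × ℝ) × Plane => (r.1.1, (r.1.2, r.2))) (by fun_prop)
  have h'' := h'.integral_prod_right (ν := (volume : Measure Plane))
  exact StronglyMeasurable.integral_prod_right
    (f := fun z l => ∫ x, crKernel f₁ f₂ f₃ z (l, x)) h''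

/-- The square of the `L²` norm. -/
def normSq2 (f : Plane → ℂ) : ℝ≥0∞ := ∫⁻ x, ‖f x‖ₑ ^ 2

/-- Cauchy-Schwarz in `(λ, x)` at fixed `z` separates `f₃` from the product `f₁ f₂`. The `f₃` factor
is `π ‖f₃‖²` for every `z`; the other, integrated in `z`, is `π ‖f₁‖² ‖f₂‖²`. Each `π` is `∫ (1 +
λ²)⁻¹ dλ`. -/
theorem lintegral_sq_crKernel_le (h₁ : Measurable f₁) (h₂ : Measurable f₂)
    (h₃ : Measurable f₃) :
    ∫⁻ z, (∫⁻ p, ‖crKernel f₁ f₂ f₃ z p‖ₑ) ^ 2 ≤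
      ENNReal.ofReal Real.pi ^ 2 * (normSq2 f₁ * normSq2 f₂ * normSq2 f₃) := by
  have hp := measurable_perp
  have hz : ∀ z, (∫⁻ p, ‖crKernel f₁ f₂ f₃ z p‖ₑ) ^ 2 ≤
      (∫⁻ p : ℝ × Plane, ‖f₁ (p.2 + z)‖ₑ ^ 2 * ‖f₂ (p.1 • perp p.2 + z)‖ₑ ^ 2) *
        (ENNReal.ofReal Real.pi * normSq2 f₃) := by
    intro z
    have e : ∀ p, ‖crKernel f₁ f₂ f₃ z p‖ₑ = (‖f₁ (p.2 + z)‖ₑ * ‖f₂ (p.1 • perp p.2 + z)‖ₑ) *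
        ‖f₃ (p.2 + p.1 • perp p.2 + z)‖ₑ := by
      intro p
      simp only [crKernel, enorm_mul]
      congr 1
      rw [← ofReal_norm, RCLike.norm_conj, ofReal_norm]
    simp_rw [e]
    refine (sq_lintegral_mul_le _ (by fun_prop) (by fun_prop)).trans (le_of_eq ?_)
    congr 1
    · simp_rw [mul_pow]
    · rw [Measure.volume_eq_prod, lintegral_prod _ (by fun_prop)]
      have : ∀ l : ℝ, ∫⁻ x, ‖f₃ (x + l • perp x + z)‖ₑ ^ 2 =
          ENNReal.ofReal (1 + l ^ 2)⁻¹ * normSq2 f₃ := by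
        intro l
        have := lintegral_similarity_add (c := 1) (l := l) (by positivity) z
          (g := fun x => ‖f₃ x‖ₑ ^ 2) (by fun_prop)
        simpa [normSq2] using this
      simp_rw [this]
      rw [lintegral_mul_const _ (by fun_prop), lintegral_inv_one_add_sq]
  calc ∫⁻ z, (∫⁻ p, ‖crKernel f₁ f₂ f₃ z p‖ₑ) ^ 2
      ≤ ∫⁻ z, (∫⁻ p : ℝ × Plane, ‖f₁ (p.2 + z)‖ₑ ^ 2 * ‖f₂ (p.1 • perp p.2 + z)‖ₑ ^ 2) *
        (ENNReal.ofReal Real.pi * normSq2 f₃) := lintegral_mono hz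
    _ = (∫⁻ z, ∫⁻ p : ℝ × Plane, ‖f₁ (p.2 + z)‖ₑ ^ 2 * ‖f₂ (p.1 • perp p.2 + z)‖ₑ ^ 2) *
        (ENNReal.ofReal Real.pi * normSq2 f₃) := by
      refine lintegral_mul_const _ (Measurable.lintegral_prod_right' (f := fun q : Plane × ℝ × Plane =>
        ‖f₁ (q.2.2 + q.1)‖ₑ ^ 2 * ‖f₂ (q.2.1 • perp q.2.2 + q.1)‖ₑ ^ 2) (by fun_prop))
    _ = (ENNReal.ofReal Real.pi * (normSq2 f₁ * normSq2 f₂)) *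
        (ENNReal.ofReal Real.pi * normSq2 f₃) := by
      congr 1
      rw [lintegral_lintegral_swap (by
        refine Measurable.aemeasurable ?_
        simp only [Function.uncurry_def]
        fun_prop), Measure.volume_eq_prod, lintegral_prod _ (by
        refine (Measurable.lintegral_prod_right' (f := fun q : (ℝ × Plane) × Plane =>
          ‖f₁ (q.1.2 + q.2)‖ₑ ^ 2 * ‖f₂ (q.1.1 • perp q.1.2 + q.2)‖ₑ ^ 2)
          (by fun_prop)).aemeasurable)]
      have : ∀ l : ℝ, ∫⁻ x, ∫⁻ z, ‖f₁ (x + z)‖ₑ ^ 2 * ‖f₂ (l • perp x + z)‖ₑ ^ 2 =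
          ENNReal.ofReal (1 + l ^ 2)⁻¹ * (normSq2 f₁ * normSq2 f₂) := fun l =>
        lintegral_lintegral_corner l (g := fun x => ‖f₁ x‖ₑ ^ 2) (h := fun x => ‖f₂ x‖ₑ ^ 2)
          (by fun_prop) (by fun_prop)
      simp_rw [this]
      rw [lintegral_mul_const _ (by fun_prop), lintegral_inv_one_add_sq]
    _ = _ := by ring

theorem normSq2_lt_top (h : MemLp f₁ 2) : normSq2 f₁ < ∞ := by
  have := (eLpNorm_lt_top_iff_lintegral_rpow_enorm_lt_top two_ne_zero ENNReal.ofNat_ne_top).1 h.2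
  simpa [normSq2] using this

theorem eLpNorm_two_sq (f : Plane → ℂ) : eLpNorm f 2 volume ^ 2 = normSq2 f := by
  rw [eLpNorm_eq_lintegral_rpow_enorm_toReal two_ne_zero ENNReal.ofNat_ne_top,
    ← ENNReal.rpow_natCast, ← ENNReal.rpow_mul]
  simp [normSq2]

theorem enorm_crT_le (h₁ : Measurable f₁) (h₂ : Measurable f₂) (h₃ : Measurable f₃) (z : Plane) :
    ‖crT f₁ f₂ f₃ z‖ₑ ≤ ∫⁻ p, ‖crKernel f₁ f₂ f₃ z p‖ₑ := by
  rw [crT_eq, Measure.volume_eq_prod,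
    lintegral_prod _ (measurable_crKernel h₁ h₂ h₃ z).enorm.aemeasurable]
  exact (enorm_integral_le_lintegral_enorm _).trans
    (lintegral_mono fun l => enorm_integral_le_lintegral_enorm _)

theorem eLpNorm_crT_le (h₁ : Measurable f₁) (h₂ : Measurable f₂) (h₃ : Measurable f₃) :
    eLpNorm (crT f₁ f₂ f₃) 2 volume ≤ ENNReal.ofReal Real.pi *
      (eLpNorm f₁ 2 volume * eLpNorm f₂ 2 volume * eLpNorm f₃ 2 volume) := by
  rw [← ENNReal.pow_le_pow_left_iff two_ne_zero, mul_pow, mul_pow, mul_pow]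
  simp_rw [eLpNorm_two_sq]
  refine le_trans (lintegral_mono fun z => ?_) (lintegral_sq_crKernel_le h₁ h₂ h₃)
  exact pow_le_pow_left₀ zero_le (enorm_crT_le h₁ h₂ h₃ z) 2

theorem memLp_crT (h₁ : Measurable f₁) (h₂ : Measurable f₂) (h₃ : Measurable f₃)
    (m₁ : MemLp f₁ 2) (m₂ : MemLp f₂ 2) (m₃ : MemLp f₃ 2) : MemLp (crT f₁ f₂ f₃) 2 := by
  refine ⟨(stronglyMeasurable_crT h₁ h₂ h₃).aestronglyMeasurable,
    (eLpNorm_crT_le h₁ h₂ h₃).trans_lt ?_⟩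
  exact ENNReal.mul_lt_top ENNReal.ofReal_lt_top
    (ENNReal.mul_lt_top (ENNReal.mul_lt_top m₁.2 m₂.2) m₃.2)

theorem ae_integrable_crKernel (h₁ : Measurable f₁) (h₂ : Measurable f₂) (h₃ : Measurable f₃)
    (m₁ : MemLp f₁ 2) (m₂ : MemLp f₂ 2) (m₃ : MemLp f₃ 2) :
    ∀ᵐ z, Integrable (crKernel f₁ f₂ f₃ z) := by
  have hlt : ∫⁻ z, (∫⁻ p, ‖crKernel f₁ f₂ f₃ z p‖ₑ) ^ 2 ≠ ∞ := by
    refine ((lintegral_sq_crKernel_le h₁ h₂ h₃).trans_lt ?_).ne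
    exact ENNReal.mul_lt_top (by simp [ENNReal.ofReal_lt_top])
      (ENNReal.mul_lt_top (ENNReal.mul_lt_top (normSq2_lt_top m₁) (normSq2_lt_top m₂))
        (normSq2_lt_top m₃))
  have hm : Measurable fun z => (∫⁻ p, ‖crKernel f₁ f₂ f₃ z p‖ₑ) ^ 2 :=
    (Measurable.lintegral_prod_right' (f := fun q : Plane × ℝ × Plane =>
      ‖crKernel f₁ f₂ f₃ q.1 q.2‖ₑ) (measurable_uncurry_crKernel h₁ h₂ h₃).enorm).pow_const 2
  filter_upwards [ae_lt_top hm hlt] with z hz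
  refine ⟨(measurable_crKernel h₁ h₂ h₃ z).aestronglyMeasurable, ?_⟩
  rw [HasFiniteIntegral]
  by_contra h
  rw [not_lt, top_le_iff] at h
  simp [h] at hz

/-- The operator is defined by an iterated integral; additivity and duality are proved on the joint
integral, available for almost every `z` by `ae_integrable_crKernel`. -/
theorem crT_eq_integral {z : Plane} (h : Integrable (crKernel f₁ f₂ f₃ z)) :
    crT f₁ f₂ f₃ z = ∫ p, crKernel f₁ f₂ f₃ z p := by
  rw [Measure.volume_eq_prod, integral_prod _ (by rwa [← Measure.volume_eq_prod]), crT_eq]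

theorem crT_congr {g₁ g₂ g₃ : Plane → ℂ} (h₁ : f₁ =ᵐ[volume] g₁) (h₂ : f₂ =ᵐ[volume] g₂)
    (h₃ : f₃ =ᵐ[volume] g₃) : crT f₁ f₂ f₃ = crT g₁ g₂ g₃ := by
  ext z
  refine integral_congr_ae ?_
  -- At `l = 0` the point `l • perp x + z` does not depend on `x`, so changing `f₂` on a null set
  -- could matter; this single value is negligible.
  have h0 : ∀ᵐ l : ℝ, l ≠ 0 := by
    simp [ae_iff, measure_singleton]
  filter_upwards [h0] with l hl
  refine integral_congr_ae ?_
  have e1 := (quasiMeasurePreserving_similarity_add (c := 1) (l := 0) (by norm_num) z).ae_eq_comp h₁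
  have e2 := (quasiMeasurePreserving_similarity_add (c := 0) (l := l) (by positivity) z).ae_eq_comp
    h₂
  have e3 := (quasiMeasurePreserving_similarity_add (c := 1) (l := l) (by positivity) z).ae_eq_comp
    h₃
  filter_upwards [e1, e2, e3] with x h1 h2 h3
  simp only [Function.comp, one_smul, zero_smul, add_zero, zero_add] at h1 h2 h3
  rw [h1, h2, h3]

end Kernel

/-! ### Symmetries of the operator, conservation of mass and well-posedness -/

section Operator

open scoped ENNReal ComplexConjugate

/-- The quadrilinear form obtained by freezing the aspect ratio `l` of the rectangles. -/
def crForm (l : ℝ) (f₁ f₂ f₃ f₄ : Plane → ℂ) : ℂ :=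
  ∫ x : Plane, ∫ z : Plane,
    f₁ (x + z) * f₂ (l • perp x + z) * conj (f₃ (x + l • perp x + z)) * conj (f₄ z)

/-- The same rectangles are based at the vertex `x + z` instead of `z`. This exchanges the vertices
of `f₁` and `f₄` and those of `f₂` and `f₃`, and reverses the orientation of the rectangle, hence
the sign of `l`. -/
theorem crForm_conj (l : ℝ) (f₁ f₂ f₃ f₄ : Plane → ℂ) :
    conj (crForm (-l) f₄ f₃ f₂ f₁) = crForm l f₁ f₂ f₃ f₄ := by
  rw [crForm, crForm, ← integral_conj, ← integral_neg_eq_self]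
  congr 1
  ext x
  rw [← integral_conj, ← integral_add_left_eq_self _ x]
  congr 1
  ext z
  simp only [map_mul, Complex.conj_conj, perp_neg]
  rw [show -x + (x + z) = z by abel, show (-l) • -perp x + (x + z) = x + l • perp x + z by
    rw [neg_smul_neg]; abel, show -x + (-l) • -perp x + (x + z) = l • perp x + z by
    rw [neg_smul_neg]; abel]
  ring

/-- A half-turn about the centre of the rectangle: the base point becomes the opposite vertex and
`x` becomes `-x`. -/
theorem crForm_swap (l : ℝ) (f₁ f₂ f₃ f₄ : Plane → ℂ) :
    crForm l f₂ f₁ f₄ f₃ = crForm l f₁ f₂ f₃ f₄ := by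
  rw [crForm, crForm, ← integral_neg_eq_self]
  congr 1
  ext x
  rw [← integral_add_left_eq_self _ (x + l • perp x)]
  congr 1
  ext z
  simp only [perp_neg, smul_neg]
  rw [show -x + (x + l • perp x + z) = l • perp x + z by abel,
    show -(l • perp x) + (x + l • perp x + z) = x + z by abel,
    show -x + -(l • perp x) + (x + l • perp x + z) = z by abel]
  ring

variable {f₁ f₂ f₃ f₄ : Plane → ℂ}

theorem integrable_conj_mul_crKernel (h₁ : Measurable f₁) (h₂ : Measurable f₂)
    (h₃ : Measurable f₃) (h₄ : Measurable f₄) (m₁ : MemLp f₁ 2) (m₂ : MemLp f₂ 2)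
    (m₃ : MemLp f₃ 2) (m₄ : MemLp f₄ 2) :
    Integrable (Function.uncurry fun (z : Plane) (p : ℝ × Plane) =>
      crKernel f₁ f₂ f₃ z p * conj (f₄ z)) (volume.prod volume) := by
  have hc : Measurable (starRingEnd ℂ) := Complex.continuous_conj.measurable
  have hk := measurable_uncurry_crKernel h₁ h₂ h₃
  have hmeas : Measurable (Function.uncurry fun (z : Plane) (p : ℝ × Plane) =>
      crKernel f₁ f₂ f₃ z p * conj (f₄ z)) :=
    hk.mul (hc.comp (h₄.comp measurable_fst))
  refine ⟨hmeas.aestronglyMeasurable, ?_⟩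
  rw [HasFiniteIntegral, lintegral_prod _ hmeas.enorm.aemeasurable]
  simp only [Function.uncurry_apply_pair, enorm_mul]
  have hM : Measurable fun z => ∫⁻ p, ‖crKernel f₁ f₂ f₃ z p‖ₑ :=
    Measurable.lintegral_prod_right' (f := fun q : Plane × ℝ × Plane =>
      ‖crKernel f₁ f₂ f₃ q.1 q.2‖ₑ) hk.enorm
  have e : ∀ z, ∫⁻ p, ‖crKernel f₁ f₂ f₃ z p‖ₑ * ‖conj (f₄ z)‖ₑ =
      (∫⁻ p, ‖crKernel f₁ f₂ f₃ z p‖ₑ) * ‖f₄ z‖ₑ := by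
    intro z
    rw [lintegral_mul_const _ (measurable_crKernel h₁ h₂ h₃ z).enorm]
    congr 1
    rw [← ofReal_norm, RCLike.norm_conj, ofReal_norm]
  simp_rw [e]
  have hle := sq_lintegral_mul_le volume hM h₄.enorm
  have hlt : (∫⁻ z, (∫⁻ p, ‖crKernel f₁ f₂ f₃ z p‖ₑ) * ‖f₄ z‖ₑ) ^ 2 < ∞ := by
    refine hle.trans_lt (ENNReal.mul_lt_top ?_ (normSq2_lt_top m₄))
    refine (lintegral_sq_crKernel_le h₁ h₂ h₃).trans_lt ?_
    exact ENNReal.mul_lt_top (by simp [ENNReal.ofReal_lt_top])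
      (ENNReal.mul_lt_top (ENNReal.mul_lt_top (normSq2_lt_top m₁) (normSq2_lt_top m₂))
        (normSq2_lt_top m₃))
  simpa using hlt

theorem integral_crT_mul_conj (h₁ : Measurable f₁) (h₂ : Measurable f₂)
    (h₃ : Measurable f₃) (h₄ : Measurable f₄) (m₁ : MemLp f₁ 2) (m₂ : MemLp f₂ 2)
    (m₃ : MemLp f₃ 2) (m₄ : MemLp f₄ 2) :
    ∫ z, crT f₁ f₂ f₃ z * conj (f₄ z) = ∫ l, crForm l f₁ f₂ f₃ f₄ := by
  have hint := integrable_conj_mul_crKernel h₁ h₂ h₃ h₄ m₁ m₂ m₃ m₄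
  have e : ∫ z, crT f₁ f₂ f₃ z * conj (f₄ z) =
      ∫ z, ∫ p, crKernel f₁ f₂ f₃ z p * conj (f₄ z) := by
    refine integral_congr_ae ?_
    filter_upwards [ae_integrable_crKernel h₁ h₂ h₃ m₁ m₂ m₃] with z hz
    rw [crT_eq_integral hz, integral_mul_const]
  rw [e, integral_integral_swap hint, Measure.volume_eq_prod, integral_prod]
  · rfl
  · rw [← Measure.volume_eq_prod]
    exact hint.integral_prod_right

theorem measurable_L2 (f : L2) : Measurable (f : Plane → ℂ) := (Lp.stronglyMeasurable f).measurable

/-- The trilinear operator on `L²(ℝ²)`. -/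
def crOp (f₁ f₂ f₃ : L2) : L2 :=
  (memLp_crT (measurable_L2 f₁) (measurable_L2 f₂) (measurable_L2 f₃) (Lp.memLp f₁) (Lp.memLp f₂)
    (Lp.memLp f₃)).toLp (crT f₁ f₂ f₃)

theorem coeFn_crOp (f₁ f₂ f₃ : L2) : crOp f₁ f₂ f₃ =ᵐ[volume] crT f₁ f₂ f₃ := MemLp.coeFn_toLp _

theorem norm_crOp_le (f₁ f₂ f₃ : L2) :
    ‖crOp f₁ f₂ f₃‖ ≤ Real.pi * ‖f₁‖ * ‖f₂‖ * ‖f₃‖ := by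
  rw [crOp, Lp.norm_toLp]
  have h := eLpNorm_crT_le (measurable_L2 f₁) (measurable_L2 f₂) (measurable_L2 f₃)
  have hne : ENNReal.ofReal Real.pi * (eLpNorm f₁ 2 volume * eLpNorm f₂ 2 volume *
      eLpNorm f₃ 2 volume) ≠ ∞ :=
    (ENNReal.mul_lt_top ENNReal.ofReal_lt_top (ENNReal.mul_lt_top
      (ENNReal.mul_lt_top (Lp.memLp f₁).2 (Lp.memLp f₂).2) (Lp.memLp f₃).2)).ne
  refine (ENNReal.toReal_mono hne h).trans (le_of_eq ?_)
  simp only [ENNReal.toReal_mul, ENNReal.toReal_ofReal Real.pi_pos.le, Lp.norm_def]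
  ring

theorem inner_crOp (f₁ f₂ f₃ f₄ : L2) :
    inner ℂ f₄ (crOp f₁ f₂ f₃) = ∫ l, crForm l f₁ f₂ f₃ f₄ := by
  rw [← integral_crT_mul_conj (measurable_L2 f₁) (measurable_L2 f₂) (measurable_L2 f₃)
    (measurable_L2 f₄) (Lp.memLp f₁) (Lp.memLp f₂) (Lp.memLp f₃) (Lp.memLp f₄), L2.inner_def]
  refine integral_congr_ae ?_
  filter_upwards [coeFn_crOp f₁ f₂ f₃] with z hz
  rw [hz, RCLike.inner_apply]

theorem inner_crOp_conj (f₁ f₂ f₃ f₄ : L2) :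
    conj (inner ℂ f₁ (crOp f₄ f₃ f₂)) = inner ℂ f₄ (crOp f₁ f₂ f₃) := by
  rw [inner_crOp, inner_crOp, ← integral_neg_eq_self, ← integral_conj]
  simp_rw [crForm_conj]

theorem inner_crOp_swap (f₁ f₂ f₃ f₄ : L2) :
    inner ℂ f₃ (crOp f₂ f₁ f₄) = inner ℂ f₄ (crOp f₁ f₂ f₃) := by
  rw [inner_crOp, inner_crOp]
  simp_rw [crForm_swap]

/-- The only slot where additivity needs absolute convergence of the integrals. The other two slots
follow by duality from `inner_crOp_swap` and `inner_crOp_conj`. -/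
theorem crOp_add_left (f g f₂ f₃ : L2) : crOp (f + g) f₂ f₃ = crOp f f₂ f₃ + crOp g f₂ f₃ := by
  refine Lp.ext ?_
  filter_upwards [coeFn_crOp (f + g) f₂ f₃, coeFn_crOp f f₂ f₃, coeFn_crOp g f₂ f₃,
    Lp.coeFn_add (crOp f f₂ f₃) (crOp g f₂ f₃),
    ae_integrable_crKernel (measurable_L2 f) (measurable_L2 f₂) (measurable_L2 f₃)
      (Lp.memLp f) (Lp.memLp f₂) (Lp.memLp f₃),
    ae_integrable_crKernel (measurable_L2 g) (measurable_L2 f₂) (measurable_L2 f₃)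
      (Lp.memLp g) (Lp.memLp f₂) (Lp.memLp f₃)] with z h1 h2 h3 h4 i1 i2
  have e : crKernel (⇑f + ⇑g) f₂ f₃ z = crKernel f f₂ f₃ z + crKernel g f₂ f₃ z := by
    ext p
    simp only [crKernel, Pi.add_apply]
    ring
  rw [h1, h4, Pi.add_apply, h2, h3, crT_congr (Lp.coeFn_add f g) (ae_eq_refl _) (ae_eq_refl _),
    crT_eq_integral (by rw [e]; exact i1.add i2), crT_eq_integral i1, crT_eq_integral i2, e]
  exact integral_add i1 i2

theorem crOp_smul_left (c : ℂ) (f f₂ f₃ : L2) : crOp (c • f) f₂ f₃ = c • crOp f f₂ f₃ := by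
  refine Lp.ext ?_
  filter_upwards [coeFn_crOp (c • f) f₂ f₃, coeFn_crOp f f₂ f₃,
    Lp.coeFn_smul c (crOp f f₂ f₃)] with z h1 h2 h3
  rw [h1, h3, Pi.smul_apply, h2, crT_congr (Lp.coeFn_smul c f) (ae_eq_refl _) (ae_eq_refl _),
    crT, crT, smul_eq_mul, ← integral_const_mul]
  simp_rw [← integral_const_mul, Pi.smul_apply, smul_eq_mul, mul_assoc]

theorem crOp_add_mid (f₁ f g f₃ : L2) : crOp f₁ (f + g) f₃ = crOp f₁ f f₃ + crOp f₁ g f₃ := by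
  refine ext_inner_left ℂ fun w => ?_
  rw [inner_add_right, ← inner_crOp_swap, ← inner_crOp_swap f₁ f, ← inner_crOp_swap f₁ g,
    crOp_add_left, inner_add_right]

theorem crOp_smul_mid (c : ℂ) (f₁ f f₃ : L2) : crOp f₁ (c • f) f₃ = c • crOp f₁ f f₃ := by
  refine ext_inner_left ℂ fun w => ?_
  rw [inner_smul_right, ← inner_crOp_swap, ← inner_crOp_swap f₁ f, crOp_smul_left,
    inner_smul_right]

theorem crOp_add_right (f₁ f₂ f g : L2) : crOp f₁ f₂ (f + g) = crOp f₁ f₂ f + crOp f₁ f₂ g := by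
  refine ext_inner_left ℂ fun w => ?_
  rw [inner_add_right, ← inner_crOp_conj, ← inner_crOp_conj f₁ f₂ f, ← inner_crOp_conj f₁ f₂ g,
    crOp_add_mid, inner_add_right, map_add]

theorem crOp_smul_right (c : ℂ) (f₁ f₂ f : L2) : crOp f₁ f₂ (c • f) = conj c • crOp f₁ f₂ f := by
  refine ext_inner_left ℂ fun w => ?_
  rw [inner_smul_right, ← inner_crOp_conj, ← inner_crOp_conj f₁ f₂ f, crOp_smul_mid,
    inner_smul_right, map_mul]

theorem real_smul_eq (c : ℝ) (f : L2) : c • f = (c : ℂ) • f := by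
  rw [← algebraMap_smul ℂ c f, Complex.coe_algebraMap]

/-- The trilinear operator with its first argument fixed, as a bounded real-bilinear map. -/
def crOpL₂ (f₁ : L2) : L2 →L[ℝ] L2 →L[ℝ] L2 :=
  LinearMap.mkContinuous₂
    (LinearMap.mk₂ ℝ (fun f₂ f₃ => crOp f₁ f₂ f₃) (fun _ _ _ => crOp_add_mid _ _ _ _)
      (fun c f g => by simp_rw [real_smul_eq, crOp_smul_mid])
      (fun _ _ _ => crOp_add_right _ _ _ _)
      (fun c f g => by simp_rw [real_smul_eq, crOp_smul_right, Complex.conj_ofReal]))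
    (Real.pi * ‖f₁‖) (fun f₂ f₃ => norm_crOp_le f₁ f₂ f₃)

theorem norm_crOpL₂_le (f₁ : L2) : ‖crOpL₂ f₁‖ ≤ Real.pi * ‖f₁‖ :=
  LinearMap.mkContinuous₂_norm_le _ (by positivity) _

/-- The trilinear operator as a bounded real-trilinear map. -/
def crOpL : L2 →L[ℝ] L2 →L[ℝ] L2 →L[ℝ] L2 :=
  LinearMap.mkContinuous
    { toFun := crOpL₂
      map_add' := fun f g => by
        ext1 f₂; ext1 f₃
        exact crOp_add_left _ _ _ _
      map_smul' := fun c f => by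
        ext1 f₂; ext1 f₃
        change crOp (c • f) f₂ f₃ = c • crOp f f₂ f₃
        simp_rw [real_smul_eq, crOp_smul_left] }
    Real.pi norm_crOpL₂_le

@[simp]
theorem crOpL_apply (f₁ f₂ f₃ : L2) : crOpL f₁ f₂ f₃ = crOp f₁ f₂ f₃ := rfl

/-- The vector field of the continuous resonant system. -/
def crField (u : L2) : L2 := -(Complex.I • crOp u u u)

theorem isCRSolution_iff {u : ℝ → L2} :
    IsCRSolution u ↔ ∀ t, HasDerivAt u (crField (u t)) t := by
  constructor
  · intro h t
    obtain ⟨v, hv, he⟩ := h t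
    convert hv using 1
    have : Complex.I • v = crOp (u t) (u t) (u t) := by
      refine Lp.ext ?_
      filter_upwards [Lp.coeFn_smul Complex.I v, he, coeFn_crOp (u t) (u t) (u t)] with z h1 h2 h3
      rw [h1, h3, ← h2, Pi.smul_apply, smul_eq_mul]
    rw [crField, ← this, smul_smul, Complex.I_mul_I, neg_one_smul, neg_neg]
  · intro h t
    refine ⟨_, h t, ?_⟩
    have : Complex.I • crField (u t) = crOp (u t) (u t) (u t) := by
      rw [crField, smul_neg, smul_smul, Complex.I_mul_I, neg_one_smul, neg_neg]
    filter_upwards [Lp.coeFn_smul Complex.I (crField (u t)), coeFn_crOp (u t) (u t) (u t)]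
      with z h1 h2
    rw [← h2, ← this, h1, Pi.smul_apply, smul_eq_mul]

theorem re_inner_I_smul {u v : L2} (h : conj (inner ℂ u v) = inner ℂ u v) :
    (inner ℂ u (-(Complex.I • v))).re = 0 := by
  rw [inner_neg_right, inner_smul_right]
  simp [Complex.conj_eq_iff_im.1 h]

theorem hasFDerivAt_norm_sq (u : L2) :
    HasFDerivAt (fun v : L2 => ‖v‖ ^ 2) (2 • innerSL ℝ u) u :=
  (hasStrictFDerivAt_norm_sq u).hasFDerivAt

/-- The real inner product on `L2` comes from the one on the values in `ℂ`, not by restriction of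
scalars, so the two have to be compared. -/
theorem inner_real_eq (u v : L2) : inner ℝ u v = (inner ℂ u v).re := by
  rw [L2.inner_def, L2.inner_def]
  have h := integral_re (L2.integrable_inner (𝕜 := ℂ) u v)
  simp only [RCLike.re_to_complex] at h
  rw [← h]
  refine integral_congr_ae (Eventually.of_forall fun x => ?_)
  simp only [Complex.inner]
  simp

/-- Conservation of mass: `⟪u, T(u,u,u)⟫` equals its own conjugate, so multiplying by `-i` leaves no
real part. -/
theorem innerSL_crField (u : L2) : (2 • innerSL ℝ u) (crField u) = 0 := by
  have : inner ℝ u (crField u) = 0 := by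
    rw [inner_real_eq, crField]
    exact re_inner_I_smul (inner_crOp_conj u u u u)
  simp [this]

theorem exists_lipschitzOnWith_crField (R : ℝ) :
    ∃ K, LipschitzOnWith K crField (Metric.closedBall 0 R) := by
  rcases lt_or_ge R 0 with hR | hR
  · rw [Metric.closedBall_eq_empty.2 hR]
    exact ⟨0, fun _ h => h.elim⟩
  refine ⟨NNReal.mk (3 * Real.pi * R ^ 2) (by positivity), LipschitzOnWith.of_dist_le_mul ?_⟩
  intro u hu v hv
  rw [mem_closedBall_zero_iff] at hu hv
  rw [dist_eq_norm, dist_eq_norm, NNReal.coe_mk]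
  have e : crField u - crField v = -(Complex.I • (crOpL (u - v) u u + crOpL v (u - v) u +
      crOpL v v (u - v))) := by
    simp only [map_sub, sub_apply, crField, crOpL_apply, smul_add, smul_sub]
    abel
  rw [e, norm_neg, norm_smul, Complex.norm_I, one_mul]
  refine (norm_add₃_le).trans ?_
  simp only [crOpL_apply]
  have h1 := norm_crOp_le (u - v) u u
  have h2 := norm_crOp_le v (u - v) u
  have h3 := norm_crOp_le v v (u - v)
  have b1 : Real.pi * ‖u - v‖ * ‖u‖ * ‖u‖ ≤ Real.pi * ‖u - v‖ * R * R := by gcongr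
  have b2 : Real.pi * ‖v‖ * ‖u - v‖ * ‖u‖ ≤ Real.pi * R * ‖u - v‖ * R := by gcongr
  have b3 : Real.pi * ‖v‖ * ‖v‖ * ‖u - v‖ ≤ Real.pi * R * R * ‖u - v‖ := by gcongr
  nlinarith

theorem existsUnique_crFlow : ∃! Φ : ℝ → L2 → L2, IsCRFlow Φ := by
  choose γ hγ0 hγ using exists_curve hasFDerivAt_norm_sq innerSL_crField
    exists_lipschitzOnWith_crField
  refine ⟨fun t f => γ f t, fun f => ⟨hγ0 f, isCRSolution_iff.2 (hγ f)⟩, fun Φ hΦ => ?_⟩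
  ext1 t
  ext1 f
  have := curve_unique hasFDerivAt_norm_sq innerSL_crField exists_lipschitzOnWith_crField
    (isCRSolution_iff.1 (hΦ f).2) (hγ f) (t₀ := 0) ((hΦ f).1.trans (hγ0 f).symm)
  exact congrFun this t

end Operator

/-! ### The Gaussian as a Schwartz function -/

section GroundState

/-- The power is absorbed in `M! exp (1 + t)`, and `1 + t - t²/2 ≤ 3/2` by completing the square. -/
theorem one_add_pow_mul_exp_le (M : ℕ) {t : ℝ} (ht : 0 ≤ t) :
    (1 + t) ^ M * Real.exp (-(t ^ 2 / 2)) ≤ M.factorial * Real.exp (3 / 2) := by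
  have h1 : (1 + t) ^ M ≤ M.factorial * Real.exp (1 + t) := by
    have := Real.pow_div_factorial_le_exp (1 + t) (by positivity) M
    rwa [div_le_iff₀ (by positivity), mul_comm] at this
  calc (1 + t) ^ M * Real.exp (-(t ^ 2 / 2))
      ≤ M.factorial * Real.exp (1 + t) * Real.exp (-(t ^ 2 / 2)) := by gcongr
    _ = M.factorial * Real.exp (1 + t + -(t ^ 2 / 2)) := by rw [Real.exp_add (1 + t)]; ring
    _ ≤ M.factorial * Real.exp (3 / 2) := by
      gcongr
      nlinarith [sq_nonneg (t - 1)]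

/-- The real Gaussian `exp (-|x|² / 2)` as a Schwartz function. -/
def realGround : 𝓢(Plane, ℝ) where
  toFun := Real.exp ∘ fun x => -(‖x‖ ^ 2 / 2)
  smooth' := Real.contDiff_exp.comp ((contDiff_norm_sq ℝ).div_const 2).neg
  decay' := by
    intro m n
    have hf : Function.HasTemperateGrowth (fun x : Plane => -(‖x‖ ^ 2 / 2)) := by
      have h := (Function.HasTemperateGrowth.const (E := Plane) (-(1 / 2) : ℝ)).mul
        (Function.hasTemperateGrowth_norm_sq Plane)
      have e : (fun x : Plane => -(‖x‖ ^ 2 / 2)) =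
          (fun _ : Plane => (-(1 / 2) : ℝ)) * fun x : Plane => ‖x‖ ^ 2 := by
        ext x
        simp only [Pi.mul_apply]
        ring
      rw [e]
      exact h
    obtain ⟨k, C, hC0, hC⟩ := hf.norm_iteratedFDeriv_le_uniform n
    refine ⟨n.factorial * (C + 1) ^ n * ((m + k * n).factorial * Real.exp (3 / 2)), fun x => ?_⟩
    -- The bound for derivatives of a composition asks for the `i`-th derivative to be at most `D ^
    -- i`. A uniform bound by `D` gives this once `D ≥ 1`, hence `C + 1`.
    have hD1 : 1 ≤ (C + 1) * (1 + ‖x‖) ^ k := by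
      have : (1 : ℝ) ≤ (1 + ‖x‖) ^ k := one_le_pow₀ (by linarith [norm_nonneg x])
      nlinarith
    have h := norm_iteratedFDeriv_comp_le (𝕜 := ℝ) (n := n) (N := ⊤) (g := Real.exp)
      (f := fun x : Plane => -(‖x‖ ^ 2 / 2)) Real.contDiff_exp
      ((contDiff_norm_sq ℝ).div_const 2).neg (by exact_mod_cast le_top) x
      (C := Real.exp (-(‖x‖ ^ 2 / 2))) (D := (C + 1) * (1 + ‖x‖) ^ k)
      (fun i _ => by
        rw [norm_iteratedFDeriv_eq_norm_iteratedDeriv, iteratedDeriv_eq_iterate,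
          Real.iter_deriv_exp, Real.norm_of_nonneg (Real.exp_pos _).le])
      (fun i hi1 hin => by
        refine (hC i hin x).trans ?_
        calc C * (1 + ‖x‖) ^ k ≤ (C + 1) * (1 + ‖x‖) ^ k := by gcongr; linarith
          _ ≤ _ := le_self_pow₀ hD1 (by omega))
    have hx : ‖x‖ ^ m ≤ (1 + ‖x‖) ^ m := by gcongr; linarith
    calc ‖x‖ ^ m * ‖iteratedFDeriv ℝ n (Real.exp ∘ fun x : Plane => -(‖x‖ ^ 2 / 2)) x‖
        ≤ (1 + ‖x‖) ^ m * (n.factorial * Real.exp (-(‖x‖ ^ 2 / 2)) *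
            ((C + 1) * (1 + ‖x‖) ^ k) ^ n) := by gcongr
      _ = n.factorial * (C + 1) ^ n *
          ((1 + ‖x‖) ^ (m + k * n) * Real.exp (-(‖x‖ ^ 2 / 2))) := by
        rw [mul_pow, pow_add, pow_mul]; ring
      _ ≤ _ := mul_le_mul_of_nonneg_left (one_add_pow_mul_exp_le _ (norm_nonneg x))
        (by positivity)

/-- The ground state `exp (-|x|² / 2)` of the harmonic oscillator. -/
def ground : 𝓢(Plane, ℂ) := realGround.postcompCLM Complex.ofRealCLM

theorem ground_apply (x : Plane) : ground x = (Real.exp (-(‖x‖ ^ 2 / 2)) : ℝ) := rfl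

end GroundState

/-! ### Ladder operators and Hermite functions -/

section Ladder

open LineDeriv
open scoped ComplexConjugate

theorem hasTemperateGrowth_inner (e : Plane) :
    Function.HasTemperateGrowth (fun x : Plane => ((inner ℝ e x : ℝ) : ℂ)) :=
  Function.Complex.hasTemperateGrowth_ofReal.comp (Function.hasTemperateGrowth_inner_right e)

/-- Multiplication by the linear form `⟪e, x⟫`. -/
def mulX (e : Plane) : 𝓢(Plane, ℂ) →ₗ[ℂ] 𝓢(Plane, ℂ) :=
  (SchwartzMap.smulLeftCLM ℂ (fun x : Plane => ((inner ℝ e x : ℝ) : ℂ))).toLinearMap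

theorem mulX_apply (e : Plane) (f : 𝓢(Plane, ℂ)) (x : Plane) :
    mulX e f x = (inner ℝ e x : ℝ) * f x :=
  SchwartzMap.smulLeftCLM_apply_apply (hasTemperateGrowth_inner e) f x

/-- The derivative in the direction `e`. -/
def dirD (e : Plane) : 𝓢(Plane, ℂ) →ₗ[ℂ] 𝓢(Plane, ℂ) :=
  (lineDerivOpCLM ℂ 𝓢(Plane, ℂ) e).toLinearMap

theorem dirD_apply (e : Plane) (f : 𝓢(Plane, ℂ)) (x : Plane) :
    dirD e f x = fderiv ℝ f x e := rfl

theorem dirD_comm (a b : Plane) (f : 𝓢(Plane, ℂ)) : dirD a (dirD b f) = dirD b (dirD a f) := by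
  ext x
  have hd : DifferentiableAt ℝ (fderiv ℝ f) x :=
    ((f.smooth 2).fderiv_right (m := 1) (by norm_num)).differentiable one_ne_zero x
  have h : ∀ a b : Plane, dirD a (dirD b f) x = fderiv ℝ (fderiv ℝ f) x a b := by
    intro a b
    rw [dirD_apply]
    have e : ((dirD b f : 𝓢(Plane, ℂ)) : Plane → ℂ) = fun y => fderiv ℝ f y b := rfl
    rw [e, fderiv_clm_apply hd (differentiableAt_const b)]
    simp
  rw [h, h]
  have hs : IsSymmSndFDerivAt ℝ f x :=
    ((f.smooth 2).contDiffAt).isSymmSndFDerivAt (by simp)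
  exact hs.eq a b

theorem dirD_mulX (a b : Plane) (f : 𝓢(Plane, ℂ)) :
    dirD a (mulX b f) = (inner ℝ a b : ℂ) • f + mulX b (dirD a f) := by
  ext x
  rw [dirD_apply]
  have e : ((mulX b f : 𝓢(Plane, ℂ)) : Plane → ℂ) = fun y => ((inner ℝ b y : ℝ) : ℂ) * f y :=
    funext fun y => mulX_apply b f y
  have h1 : HasFDerivAt (fun y : Plane => ((inner ℝ b y : ℝ) : ℂ))
      (Complex.ofRealCLM.comp (innerSL ℝ b)) x :=
    (Complex.ofRealCLM.comp (innerSL ℝ b)).hasFDerivAt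
  have h2 := (h1.mul (f.hasFDerivAt x)).fderiv
  rw [e]
  change fderiv ℝ ((fun y : Plane => ((inner ℝ b y : ℝ) : ℂ)) * ⇑f) x a = _
  rw [h2]
  simp only [add_apply, smul_apply, mulX_apply, dirD_apply]
  simp [real_inner_comm]
  ring

theorem mulX_comm (a b : Plane) (f : 𝓢(Plane, ℂ)) : mulX a (mulX b f) = mulX b (mulX a f) := by
  ext x
  simp only [mulX_apply]
  ring

/-- The annihilation operator `⟪e, x⟫ + ∂_e`. -/
def lower (e : Plane) : 𝓢(Plane, ℂ) →ₗ[ℂ] 𝓢(Plane, ℂ) := mulX e + dirD e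

/-- The creation operator `⟪e, x⟫ - ∂_e`. -/
def raise (e : Plane) : 𝓢(Plane, ℂ) →ₗ[ℂ] 𝓢(Plane, ℂ) := mulX e - dirD e

theorem lower_eq (e : Plane) (f : 𝓢(Plane, ℂ)) : lower e f = mulX e f + dirD e f := rfl

theorem raise_eq (e : Plane) (f : 𝓢(Plane, ℂ)) : raise e f = mulX e f - dirD e f := rfl

/-- The canonical commutation relation; the factor `2` reflects the absence of the usual
normalization by `√2`. -/
theorem lower_raise (a b : Plane) (f : 𝓢(Plane, ℂ)) :
    lower a (raise b f) = raise b (lower a f) + (2 * inner ℝ a b : ℂ) • f := by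
  simp only [lower_eq, raise_eq, map_add, map_sub, dirD_mulX, dirD_comm a b, mulX_comm a b,
    real_inner_comm a b]
  module

theorem raise_comm (a b : Plane) (f : 𝓢(Plane, ℂ)) : raise a (raise b f) = raise b (raise a f) := by
  simp only [raise_eq, map_sub, dirD_mulX, dirD_comm a b, mulX_comm a b, real_inner_comm a b]
  module

theorem mulX_eq (e : Plane) (f : 𝓢(Plane, ℂ)) :
    mulX e f = (2⁻¹ : ℂ) • (lower e f + raise e f) := by
  rw [lower_eq, raise_eq]
  module

theorem mulX_lin (a b : ℝ) (e e' : Plane) (f : 𝓢(Plane, ℂ)) :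
    mulX (a • e + b • e') f = (a : ℂ) • mulX e f + (b : ℂ) • mulX e' f := by
  ext x
  simp only [mulX_apply, add_apply, smul_apply, inner_add_left, real_inner_smul_left, smul_eq_mul]
  push_cast
  ring

theorem dirD_lin (a b : ℝ) (e e' : Plane) (f : 𝓢(Plane, ℂ)) :
    dirD (a • e + b • e') f = (a : ℂ) • dirD e f + (b : ℂ) • dirD e' f := by
  ext x
  simp only [dirD_apply, add_apply, smul_apply, map_add, map_smul, smul_eq_mul, Complex.real_smul]

theorem raise_lin (a b : ℝ) (e e' : Plane) (f : 𝓢(Plane, ℂ)) :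
    raise (a • e + b • e') f = (a : ℂ) • raise e f + (b : ℂ) • raise e' f := by
  simp only [raise_eq, mulX_lin, dirD_lin]
  module

theorem lower_ground (e : Plane) : lower e ground = 0 := by
  ext x
  have h1 : HasFDerivAt (fun y : Plane => -(‖y‖ ^ 2 / 2)) (-innerSL ℝ x) x := by
    have := ((hasStrictFDerivAt_norm_sq x).hasFDerivAt.mul_const (2⁻¹ : ℝ)).neg
    refine (this.congr_fderiv ?_).congr_of_eventuallyEq (Eventually.of_forall fun y => ?_)
    · ext y
      simp
    · simp [div_eq_mul_inv]
  have h2 : HasFDerivAt ground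
      (Complex.ofRealCLM.comp (Real.exp (-(‖x‖ ^ 2 / 2)) • (-innerSL ℝ x))) x :=
    Complex.ofRealCLM.hasFDerivAt.comp x h1.exp
  rw [lower_eq, add_apply, mulX_apply, dirD_apply, h2.fderiv, ground_apply]
  simp [real_inner_comm]
  ring

/-- The span of the Hermite functions of degree `n`. -/
def hermiteSpan : ℕ → Submodule ℂ 𝓢(Plane, ℂ)
  | 0 => Submodule.span ℂ {ground}
  | n + 1 => ⨆ e : Plane, (hermiteSpan n).map (raise e)

theorem raise_mem {n : ℕ} {f : 𝓢(Plane, ℂ)} (hf : f ∈ hermiteSpan n) (e : Plane) :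
    raise e f ∈ hermiteSpan (n + 1) :=
  Submodule.mem_iSup_of_mem (p := fun e : Plane => (hermiteSpan n).map (raise e)) e
    (Submodule.mem_map_of_mem hf)

theorem hermiteSpan_succ_le {n : ℕ} {S : Submodule ℂ 𝓢(Plane, ℂ)}
    (h : ∀ e, ∀ f ∈ hermiteSpan n, raise e f ∈ S) : hermiteSpan (n + 1) ≤ S :=
  iSup_le fun e => Submodule.map_le_iff_le_comap.2 fun f hf => h e f hf

theorem lower_eq_zero {f : 𝓢(Plane, ℂ)} (hf : f ∈ hermiteSpan 0) (e : Plane) : lower e f = 0 := by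
  obtain ⟨c, rfl⟩ := Submodule.mem_span_singleton.1 hf
  rw [map_smul, lower_ground, smul_zero]

theorem lower_mem {n : ℕ} {f : 𝓢(Plane, ℂ)} (hf : f ∈ hermiteSpan (n + 1)) (e : Plane) :
    lower e f ∈ hermiteSpan n := by
  suffices h : hermiteSpan (n + 1) ≤ (hermiteSpan n).comap (lower e) from h hf
  clear hf f
  induction n with
  | zero =>
    refine hermiteSpan_succ_le fun a f hf => ?_
    rw [Submodule.mem_comap, lower_raise, lower_eq_zero hf, map_zero, zero_add]
    exact Submodule.smul_mem _ _ hf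
  | succ n ih =>
    refine hermiteSpan_succ_le fun a f hf => ?_
    rw [Submodule.mem_comap, lower_raise]
    exact Submodule.add_mem _ (raise_mem (ih hf) a) (Submodule.smul_mem _ _ hf)

/-- Multiplication by a linear form is half the sum of a creation and an annihilation operator.
Hence powers of linear forms times the Gaussian stay in the algebraic sum, which is what
completeness uses. -/
theorem mulX_mem_iSup {f : 𝓢(Plane, ℂ)} (hf : f ∈ ⨆ n, hermiteSpan n) (e : Plane) :
    mulX e f ∈ ⨆ n, hermiteSpan n := by
  suffices h : ⨆ n, hermiteSpan n ≤ (⨆ n, hermiteSpan n).comap (mulX e) from h hf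
  refine iSup_le fun n f hf => ?_
  rw [Submodule.mem_comap, mulX_eq]
  refine Submodule.smul_mem _ _ (Submodule.add_mem _ ?_ ?_)
  · cases n with
    | zero => rw [lower_eq_zero hf]; exact Submodule.zero_mem _
    | succ n => exact Submodule.mem_iSup_of_mem n (lower_mem hf e)
  · exact Submodule.mem_iSup_of_mem (n + 1) (raise_mem hf e)

/-- The standard orthonormal basis of the plane. -/
def stdE (i : Fin 2) : Plane := EuclideanSpace.basisFun (Fin 2) ℝ i

theorem inner_stdE (i j : Fin 2) : inner ℝ (stdE i) (stdE j) = if i = j then (1 : ℝ) else 0 :=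
  orthonormal_iff_ite.1 (EuclideanSpace.basisFun (Fin 2) ℝ).orthonormal i j

theorem sum_inner_stdE (e : Plane) :
    inner ℝ (stdE 0) e • stdE 0 + inner ℝ (stdE 1) e • stdE 1 = e := by
  have := (EuclideanSpace.basisFun (Fin 2) ℝ).sum_repr' e
  rw [Fin.sum_univ_two] at this
  exact this

/-- The number operator in the `i`-th coordinate. -/
def number (i : Fin 2) : 𝓢(Plane, ℂ) →ₗ[ℂ] 𝓢(Plane, ℂ) := raise (stdE i) ∘ₗ lower (stdE i)

theorem number_apply (i : Fin 2) (f : 𝓢(Plane, ℂ)) :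
    number i f = raise (stdE i) (lower (stdE i) f) := rfl

theorem number_raise (i : Fin 2) (e : Plane) (f : 𝓢(Plane, ℂ)) :
    number i (raise e f) =
      raise e (number i f) + (2 * inner ℝ (stdE i) e : ℂ) • raise (stdE i) f := by
  rw [number_apply, lower_raise, map_add, map_smul, raise_comm, number_apply]

theorem number_add_number {n : ℕ} {f : 𝓢(Plane, ℂ)} (hf : f ∈ hermiteSpan n) :
    number 0 f + number 1 f = (2 * n : ℂ) • f := by
  suffices h : hermiteSpan n ≤ LinearMap.eqLocus (number 0 + number 1)
      ((2 * n : ℂ) • LinearMap.id) from h hf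
  clear hf f
  induction n with
  | zero =>
    intro f hf
    rw [LinearMap.mem_eqLocus]
    simp [number_apply, lower_eq_zero hf]
  | succ n ih =>
    refine hermiteSpan_succ_le fun e f hf => ?_
    have hf' : number 0 f + number 1 f = (2 * n : ℂ) • f := ih hf
    rw [LinearMap.mem_eqLocus]
    simp only [LinearMap.add_apply, LinearMap.smul_apply, LinearMap.id_apply, number_raise]
    have h1 : raise e f = (inner ℝ (stdE 0) e : ℂ) • raise (stdE 0) f +
        (inner ℝ (stdE 1) e : ℂ) • raise (stdE 1) f := by
      rw [← raise_lin, sum_inner_stdE]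
    have h2 : raise e (number 0 f) + raise e (number 1 f) = (2 * n : ℂ) • raise e f := by
      rw [← map_add, hf', map_smul]
    calc _ = (raise e (number 0 f) + raise e (number 1 f)) + (2 : ℂ) •
          ((inner ℝ (stdE 0) e : ℂ) • raise (stdE 0) f +
            (inner ℝ (stdE 1) e : ℂ) • raise (stdE 1) f) := by module
      _ = _ := by
        rw [h2, ← h1]
        push_cast
        module

/-- The harmonic oscillator on Schwartz functions. -/
def oscillator (f : 𝓢(Plane, ℂ)) : 𝓢(Plane, ℂ) :=
  SchwartzMap.smulLeftCLM ℂ (fun x : Plane => ((‖x‖ ^ 2 : ℝ) : ℂ)) f - Δ f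

theorem hasTemperateGrowth_norm_sq_ofReal :
    Function.HasTemperateGrowth (fun x : Plane => ((‖x‖ ^ 2 : ℝ) : ℂ)) :=
  Function.Complex.hasTemperateGrowth_ofReal.comp (Function.hasTemperateGrowth_norm_sq Plane)

/-- In each coordinate, creation after annihilation is `xᵢ² - ∂ᵢ² - 1`; the two commutators account
for the `2`. -/
theorem oscillator_eq (f : 𝓢(Plane, ℂ)) :
    oscillator f = number 0 f + number 1 f + (2 : ℂ) • f := by
  have h1 : Δ f = dirD (stdE 0) (dirD (stdE 0) f) + dirD (stdE 1) (dirD (stdE 1) f) := by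
    rw [SchwartzMap.laplacian_eq_sum (EuclideanSpace.basisFun (Fin 2) ℝ), Fin.sum_univ_two]
    rfl
  have h2 : SchwartzMap.smulLeftCLM ℂ (fun x : Plane => ((‖x‖ ^ 2 : ℝ) : ℂ)) f =
      mulX (stdE 0) (mulX (stdE 0) f) + mulX (stdE 1) (mulX (stdE 1) f) := by
    ext x
    rw [SchwartzMap.smulLeftCLM_apply_apply hasTemperateGrowth_norm_sq_ofReal, add_apply]
    simp only [mulX_apply]
    have : ‖x‖ ^ 2 = inner ℝ (stdE 0) x ^ 2 + inner ℝ (stdE 1) x ^ 2 := by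
      have := (EuclideanSpace.basisFun (Fin 2) ℝ).sum_sq_norm_inner_right x
      rw [Fin.sum_univ_two] at this
      simpa [stdE] using this.symm
    rw [this]
    push_cast
    simp only [smul_eq_mul]
    ring
  rw [oscillator, h1, h2]
  simp only [number_apply, raise_eq, lower_eq, map_add, dirD_mulX, inner_stdE]
  simp only [if_true, Complex.ofReal_one]
  module

theorem oscillator_hermite {n : ℕ} {f : 𝓢(Plane, ℂ)} (hf : f ∈ hermiteSpan n) :
    oscillator f = (2 * n + 2 : ℂ) • f := by
  rw [oscillator_eq, number_add_number hf]
  module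

/-- The Hermite functions `a₀*^j a₁*^k exp (-|x|² / 2)`. -/
def hermiteFun (j k : ℕ) : 𝓢(Plane, ℂ) := (raise (stdE 0))^[j] ((raise (stdE 1))^[k] ground)

theorem raise_zero_hermiteFun (j k : ℕ) :
    raise (stdE 0) (hermiteFun j k) = hermiteFun (j + 1) k := by
  rw [hermiteFun, hermiteFun, Function.iterate_succ_apply']

theorem raise_one_hermiteFun (j k : ℕ) :
    raise (stdE 1) (hermiteFun j k) = hermiteFun j (k + 1) := by
  induction j with
  | zero => rw [hermiteFun, hermiteFun, Function.iterate_zero_apply, Function.iterate_zero_apply,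
      Function.iterate_succ_apply']
  | succ j ih => rw [← raise_zero_hermiteFun, raise_comm, ih, raise_zero_hermiteFun]

theorem hermiteFun_mem (j k : ℕ) : hermiteFun j k ∈ hermiteSpan (j + k) := by
  induction j with
  | zero =>
    induction k with
    | zero => exact Submodule.mem_span_singleton_self _
    | succ k ih => rw [← raise_one_hermiteFun]; exact raise_mem ih _
  | succ j ih =>
    rw [← raise_zero_hermiteFun, add_right_comm]
    exact raise_mem ih _

theorem number_zero_hermiteFun (j k : ℕ) :
    number 0 (hermiteFun j k) = (2 * j : ℂ) • hermiteFun j k := by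
  induction j with
  | zero =>
    induction k with
    | zero => simp [number_apply, hermiteFun, lower_ground]
    | succ k ih =>
      rw [← raise_one_hermiteFun, number_raise, ih, inner_stdE]
      simp
  | succ j ih =>
    rw [← raise_zero_hermiteFun, number_raise, ih, inner_stdE, map_smul]
    simp only [if_true]
    push_cast
    module

theorem number_one_hermiteFun (j k : ℕ) :
    number 1 (hermiteFun j k) = (2 * k : ℂ) • hermiteFun j k := by
  have h := number_add_number (hermiteFun_mem j k)
  rw [number_zero_hermiteFun] at h
  rw [eq_sub_of_add_eq' h]
  push_cast
  module

theorem ground_ne_zero : ground ≠ 0 := by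
  intro h
  have := congrArg (fun f : 𝓢(Plane, ℂ) => f 0) h
  simp [ground_apply] at this

/-- If a creation operator killed `f`, the commutation relation would give `0 = (2m + 2) f`, with
`2m` the eigenvalue of the number operator on `f`. -/
theorem hermiteFun_ne_zero (j k : ℕ) : hermiteFun j k ≠ 0 := by
  have key : ∀ (i : Fin 2) (m : ℕ) (f : 𝓢(Plane, ℂ)), f ≠ 0 → number i f = (2 * m : ℂ) • f →
      raise (stdE i) f ≠ 0 := by
    intro i m f hf hn h0
    have h1 := lower_raise (stdE i) (stdE i) f
    rw [h0, map_zero, ← number_apply, hn, inner_stdE, if_pos rfl, ← add_smul] at h1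
    rcases smul_eq_zero.1 h1.symm with h | h
    · have : ((2 * m + 2 : ℕ) : ℂ) = 0 := by push_cast; simpa using h
      exact absurd this (Nat.cast_ne_zero.2 (by omega))
    · exact hf h
  induction j with
  | zero =>
    induction k with
    | zero => exact ground_ne_zero
    | succ k ih => rw [← raise_one_hermiteFun]; exact key 1 k _ ih (number_one_hermiteFun 0 k)
  | succ j ih => rw [← raise_zero_hermiteFun]; exact key 0 j _ ih (number_zero_hermiteFun j k)

theorem hermiteSpan_eq_span (n : ℕ) :
    hermiteSpan n = Submodule.span ℂ (Set.range fun j : Fin (n + 1) => hermiteFun j (n - j)) := by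
  apply le_antisymm
  · induction n with
    | zero =>
      refine Submodule.span_mono ?_
      rintro _ rfl
      exact ⟨0, rfl⟩
    | succ n ih =>
      refine hermiteSpan_succ_le fun e f hf => ?_
      have key : ∀ i : Fin 2, Submodule.span ℂ (Set.range fun j : Fin (n + 1) =>
          hermiteFun j (n - j)) ≤ (Submodule.span ℂ (Set.range fun j : Fin (n + 1 + 1) =>
          hermiteFun j (n + 1 - j))).comap (raise (stdE i)) := by
        intro i
        rw [Submodule.span_le]
        rintro _ ⟨j, rfl⟩
        have hj : (j : ℕ) ≤ n := Nat.lt_succ_iff.1 j.2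
        fin_cases i
        · refine Submodule.subset_span ⟨j.succ, ?_⟩
          simp only [Fin.zero_eta, raise_zero_hermiteFun, Fin.val_succ]
          congr 1
          omega
        · refine Submodule.subset_span ⟨j.castSucc, ?_⟩
          simp only [Fin.mk_one, raise_one_hermiteFun, Fin.val_castSucc]
          congr 1
          omega
      rw [← sum_inner_stdE e, raise_lin]
      exact Submodule.add_mem _ (Submodule.smul_mem _ _ (key 0 (ih hf)))
        (Submodule.smul_mem _ _ (key 1 (ih hf)))
  · rw [Submodule.span_le]
    rintro _ ⟨j, rfl⟩
    have := hermiteFun_mem j (n - j)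
    rwa [Nat.add_sub_cancel' (Nat.lt_succ_iff.1 j.2)] at this

theorem linearIndependent_hermiteFun (n : ℕ) :
    LinearIndependent ℂ fun j : Fin (n + 1) => hermiteFun j (n - j) := by
  refine Module.End.eigenvectors_linearIndependent' (number 0) (fun j : Fin (n + 1) => (2 * j : ℂ))
    ?_ _ fun j => ?_
  · intro i j hij
    have : ((i : ℕ) : ℂ) = (j : ℕ) := mul_left_cancel₀ two_ne_zero hij
    exact Fin.ext (by exact_mod_cast this)
  · exact ⟨Module.End.mem_eigenspace_iff.2 (number_zero_hermiteFun _ _), hermiteFun_ne_zero _ _⟩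

theorem finrank_hermiteSpan (n : ℕ) : Module.finrank ℂ (hermiteSpan n) = n + 1 := by
  rw [hermiteSpan_eq_span, finrank_span_eq_card (linearIndependent_hermiteFun n), Fintype.card_fin]

instance (n : ℕ) : FiniteDimensional ℂ (hermiteSpan n) :=
  Module.finite_of_finrank_pos (by rw [finrank_hermiteSpan]; omega)

/-- Complex conjugation of Schwartz functions. -/
def conjS (f : 𝓢(Plane, ℂ)) : 𝓢(Plane, ℂ) :=
  f.postcompCLM (Complex.conjCLE : ℂ →L[ℝ] ℂ)

theorem conjS_apply (f : 𝓢(Plane, ℂ)) (x : Plane) : conjS f x = conj (f x) := rfl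

theorem conjS_raise (e : Plane) (f : 𝓢(Plane, ℂ)) : conjS (raise e f) = raise e (conjS f) := by
  ext x
  have h : HasFDerivAt (conjS f) ((Complex.conjCLE : ℂ →L[ℝ] ℂ).comp (fderiv ℝ f x)) x :=
    (Complex.conjCLE : ℂ →L[ℝ] ℂ).hasFDerivAt.comp x (f.hasFDerivAt x)
  rw [conjS_apply, raise_eq, raise_eq, sub_apply, sub_apply, mulX_apply, mulX_apply, dirD_apply,
    dirD_apply, h.fderiv, conjS_apply]
  simp

/-- The ground state and the creation operators are real. This permits passing between the bilinear
pairing of distributions and the Hermitian inner product. -/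
theorem conjS_mem {n : ℕ} {f : 𝓢(Plane, ℂ)} (hf : f ∈ hermiteSpan n) : conjS f ∈ hermiteSpan n := by
  have hadd : ∀ f g, conjS (f + g) = conjS f + conjS g := fun f g => by
    ext x; simp [conjS_apply]
  have hsmul : ∀ (c : ℂ) f, conjS (c • f) = conj c • conjS f := fun c f => by
    ext x; simp [conjS_apply]
  let C : ∀ n, Submodule ℂ 𝓢(Plane, ℂ) := fun n =>
    { carrier := {f | conjS f ∈ hermiteSpan n}
      add_mem' := fun {f g} hf hg => by
        change conjS (f + g) ∈ hermiteSpan n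
        rw [hadd]; exact Submodule.add_mem _ hf hg
      zero_mem' := by
        change conjS 0 ∈ hermiteSpan n
        have : conjS 0 = 0 := by ext x; simp [conjS_apply]
        rw [this]; exact Submodule.zero_mem _
      smul_mem' := fun c f hf => by
        change conjS (c • f) ∈ hermiteSpan n
        rw [hsmul]; exact Submodule.smul_mem _ _ hf }
  suffices h : hermiteSpan n ≤ C n from h hf
  clear hf f
  induction n with
  | zero =>
    refine Submodule.span_le.2 ?_
    rintro _ rfl
    change conjS ground ∈ hermiteSpan 0
    have : conjS ground = ground := by
      ext x
      rw [conjS_apply, ground_apply, Complex.conj_ofReal]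
    rw [this]
    exact Submodule.mem_span_singleton_self _
  | succ n ih =>
    refine hermiteSpan_succ_le fun e f hf => ?_
    change conjS (raise e f) ∈ hermiteSpan (n + 1)
    rw [conjS_raise]
    exact raise_mem (ih hf) e

end Ladder

/-! ### Completeness of the Hermite functions in `L²` -/

section Completeness

open FourierTransform
open scoped ComplexConjugate

/-- The bilinear pairing of an `L²` function with Schwartz functions. -/
def pairL (v : L2) : 𝓢(Plane, ℂ) →ₗ[ℂ] ℂ where
  toFun := Lp.toTemperedDistribution v
  map_add' := map_add _
  map_smul' := map_smul _

theorem pairL_eq (v : L2) (g : 𝓢(Plane, ℂ)) : pairL v g = Lp.toTemperedDistribution v g := rfl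

theorem pairL_apply (v : L2) (g : 𝓢(Plane, ℂ)) : pairL v g = ∫ x, g x * v x :=
  Lp.toTemperedDistribution_apply v g

/-- The inclusion of Schwartz functions in `L²`. -/
def toL2 : 𝓢(Plane, ℂ) →ₗ[ℂ] L2 := (SchwartzMap.toLpCLM ℂ ℂ 2 volume).toLinearMap

theorem coeFn_toL2 (f : 𝓢(Plane, ℂ)) : toL2 f =ᵐ[volume] f := f.coeFn_toLp 2 volume

theorem toL2_injective : Function.Injective toL2 := SchwartzMap.injective_toLp 2 volume

theorem inner_toL2 (f : 𝓢(Plane, ℂ)) (v : L2) : inner ℂ (toL2 f) v = pairL v (conjS f) := by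
  rw [L2.inner_def, pairL_apply]
  refine integral_congr_ae ?_
  filter_upwards [coeFn_toL2 f] with x hx
  rw [hx, RCLike.inner_apply, conjS_apply, mul_comm]

theorem pairL_eq_inner (f : 𝓢(Plane, ℂ)) (v : L2) : pairL v f = inner ℂ (toL2 (conjS f)) v := by
  rw [inner_toL2]
  congr 1
  ext x
  simp [conjS_apply]

theorem mulX_iterate_apply (e : Plane) (n : ℕ) (f : 𝓢(Plane, ℂ)) (x : Plane) :
    ((mulX e)^[n] f) x = ((inner ℝ e x : ℝ) : ℂ) ^ n * f x := by
  induction n with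
  | zero => simp
  | succ n ih => rw [Function.iterate_succ_apply', mulX_apply, ih, pow_succ]; ring

theorem memLp_exp_mul_ground (c : ℝ) :
    MemLp (fun x : Plane => Real.exp (c * ‖x‖) * Real.exp (-(‖x‖ ^ 2 / 2))) 2 := by
  have h1 : MemLp (fun x : Plane => Real.exp (c ^ 2) * Real.exp (-(‖x‖ ^ 2 / 4))) 2 := by
    refine MemLp.const_mul ?_ _
    rw [memLp_two_iff_integrable_sq (by fun_prop)]
    have h := realGround.integrable (μ := (volume : Measure Plane))
    convert h using 1
    ext x
    change _ = Real.exp (-(‖x‖ ^ 2 / 2))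
    rw [← Real.exp_nat_mul]
    congr 1
    push_cast
    ring
  refine h1.mono (by fun_prop) (Eventually.of_forall fun x => ?_)
  rw [Real.norm_of_nonneg (by positivity), Real.norm_of_nonneg (by positivity), ← Real.exp_add,
    ← Real.exp_add, Real.exp_le_exp]
  nlinarith [sq_nonneg (c - ‖x‖ / 2)]

theorem hasSum_cexp (z : ℂ) : HasSum (fun n : ℕ => z ^ n / (n.factorial : ℂ)) (Complex.exp z) := by
  rw [Complex.exp_eq_exp_ℂ]
  exact NormedSpace.expSeries_div_hasSum_exp z

/-- An integrable function whose Fourier transform vanishes is zero almost everywhere. -/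
theorem ae_eq_zero_of_fourier_eq_zero {h : Plane → ℂ} (hint : Integrable h)
    (hF : ∀ w : Plane, 𝓕 h w = 0) : ∀ᵐ x, h x = 0 := by
  have hψ : ∀ ψ : 𝓢(Plane, ℂ), ∫ x, ψ x * h x = 0 := by
    intro ψ
    -- Moving the outer Fourier transform from `𝓕⁻ ψ` to `h` makes the pairing vanish.
    have h1 : ψ = 𝓕 (𝓕⁻ ψ) := (FourierTransform.fourier_fourierInv_eq ψ).symm
    have h2 := VectorFourier.integral_fourierIntegral_smul_eq_flip (L := innerₗ Plane)
      (μ := (volume : Measure Plane)) (ν := (volume : Measure Plane))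
      Real.continuous_fourierChar continuous_inner (𝓕⁻ ψ).integrable hint
    rw [flip_innerₗ] at h2
    have h3 : ∀ x : Plane, VectorFourier.fourierIntegral Real.fourierChar volume (innerₗ Plane)
        h x = 0 := hF
    simp_rw [h3] at h2
    rw [h1]
    refine Eq.trans ?_ (h2.trans (by simp))
    rfl
  refine ae_eq_zero_of_integral_contDiff_smul_eq_zero hint.locallyIntegrable fun g hg hgc => ?_
  exact hψ ((hgc.toSchwartzMap hg).postcompCLM Complex.ofRealCLM)

/-- An `L²` function paired to zero with all Hermite functions vanishes. -/
theorem eq_zero_of_pairL_eq_zero {v : L2} (h : ∀ n, ∀ g ∈ hermiteSpan n, pairL v g = 0) : v = 0 := by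
  have hS : ∀ g ∈ ⨆ n, hermiteSpan n, pairL v g = 0 := by
    intro g hg
    have : ⨆ n, hermiteSpan n ≤ LinearMap.ker (pairL v) :=
      iSup_le fun n g hg => LinearMap.mem_ker.2 (h n g hg)
    exact LinearMap.mem_ker.1 (this hg)
  have hpow : ∀ (w : Plane) (n : ℕ), ∫ x, ((inner ℝ w x : ℝ) : ℂ) ^ n * (ground x * v x) = 0 := by
    intro w n
    have hmem : (mulX w)^[n] ground ∈ ⨆ n, hermiteSpan n := by
      induction n with
      | zero => exact Submodule.mem_iSup_of_mem 0 (Submodule.mem_span_singleton_self _)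
      | succ n ih => rw [Function.iterate_succ_apply']; exact mulX_mem_iSup ih w
    have := hS _ hmem
    rw [pairL_apply] at this
    simpa only [mulX_iterate_apply, mul_assoc] using this
  have hvm : MemLp v 2 volume := Lp.memLp v
  have hint : Integrable (fun x => ground x * v x) :=
    (ground.memLp 2 volume).integrable_mul hvm
  have hF : ∀ w : Plane, 𝓕 (fun x => ground x * v x) w = 0 := by
    intro w
    rw [Real.fourier_eq']
    set c : ℝ := 2 * Real.pi * ‖w‖
    -- The Fourier transform of the Gaussian times `v` is expanded in powers of the phase. Every
    -- term is a vanishing moment `hpow`; the exchange is legitimate because the Gaussian beats `exp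
    -- (c ‖x‖)`.
    have key := hasSum_integral_of_dominated_convergence (μ := (volume : Measure Plane))
      (F := fun (n : ℕ) x => (((-2 * Real.pi * inner ℝ x w : ℝ) : ℂ) * Complex.I) ^ n /
        (n.factorial : ℂ) * (ground x * v x))
      (f := fun x => Complex.exp (((-2 * Real.pi * inner ℝ x w : ℝ) : ℂ) * Complex.I) •
        (ground x * v x))
      (fun n x => (c * ‖x‖) ^ n / n.factorial * (Real.exp (-(‖x‖ ^ 2 / 2)) * ‖v x‖))
      ?_ ?_ ?_ ?_ ?_
    · refine key.unique ?_
      have h0 : ∀ n : ℕ, ∫ x, (((-2 * Real.pi * inner ℝ x w : ℝ) : ℂ) * Complex.I) ^ n /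
        (n.factorial : ℂ) * (ground x * v x) = 0 := by
        intro n
        have e : ∀ x : Plane, (((-2 * Real.pi * inner ℝ x w : ℝ) : ℂ) * Complex.I) ^ n /
            (n.factorial : ℂ) * (ground x * v x) =
            (((-2 * Real.pi : ℝ) : ℂ) * Complex.I) ^ n / (n.factorial : ℂ) *
              (((inner ℝ w x : ℝ) : ℂ) ^ n * (ground x * v x)) := by
          intro x
          rw [real_inner_comm w x, Complex.ofReal_mul, mul_right_comm, mul_pow]
          ring
        simp_rw [e]
        rw [integral_const_mul, hpow, mul_zero]
      simp_rw [h0]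
      exact hasSum_zero
    · intro n
      have : Continuous fun x : Plane =>
          (((-2 * Real.pi * inner ℝ x w : ℝ) : ℂ) * Complex.I) ^ n / (n.factorial : ℂ) := by
        fun_prop
      exact this.aestronglyMeasurable.mul hint.aestronglyMeasurable
    · intro n
      refine Eventually.of_forall fun x => ?_
      rw [norm_mul, norm_div, norm_pow, norm_mul, Complex.norm_I, mul_one, norm_mul, ground_apply,
        Complex.norm_real, Complex.norm_real, Complex.norm_natCast,
        Real.norm_of_nonneg (Real.exp_pos _).le]
      gcongr
      rw [norm_mul, norm_mul, Real.norm_of_nonneg Real.pi_pos.le]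
      have := abs_real_inner_le_norm x w
      rw [Real.norm_eq_abs (inner ℝ x w)]
      simp only [c, norm_neg, Real.norm_ofNat]
      calc 2 * Real.pi * |inner ℝ x w| ≤ 2 * Real.pi * (‖x‖ * ‖w‖) := by gcongr
        _ = _ := by ring
    · refine Eventually.of_forall fun x => ?_
      exact (Real.summable_pow_div_factorial _).mul_right _
    · have e : ∀ x : Plane, ∑' n : ℕ, (c * ‖x‖) ^ n / n.factorial *
          (Real.exp (-(‖x‖ ^ 2 / 2)) * ‖v x‖) =
          Real.exp (c * ‖x‖) * Real.exp (-(‖x‖ ^ 2 / 2)) * ‖v x‖ := by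
        intro x
        rw [tsum_mul_right, Real.exp_eq_exp_ℝ, NormedSpace.exp_eq_tsum_div]
        ring
      simp_rw [e]
      exact (memLp_exp_mul_ground c).integrable_mul hvm.norm
    · refine Eventually.of_forall fun x => ?_
      exact (hasSum_cexp _).mul_right (ground x * v x)
  have hz : ∀ᵐ x, ground x * v x = 0 := ae_eq_zero_of_fourier_eq_zero hint hF
  refine (Lp.eq_zero_iff_ae_eq_zero).2 ?_
  filter_upwards [hz] with x hx
  rcases mul_eq_zero.1 hx with h | h
  · rw [ground_apply, Complex.ofReal_eq_zero] at h
    exact absurd h (Real.exp_pos _).ne'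
  · exact h

end Completeness

/-! ### The eigenspaces are spanned by Hermite functions -/

section Eigenspace

/-- The harmonic oscillator is symmetric. -/
theorem integral_oscillator_mul (f g : 𝓢(Plane, ℂ)) :
    ∫ x, oscillator g x * f x = ∫ x, g x * oscillator f x := by
  have hi : ∀ f g : 𝓢(Plane, ℂ), Integrable (fun x => f x * g x) := fun f g =>
    (f.memLp 2 volume).integrable_mul (g.memLp 2 volume)
  have h1 : ∀ (f : 𝓢(Plane, ℂ)) (x : Plane), oscillator f x = ((‖x‖ ^ 2 : ℝ) : ℂ) * f x - Δ f x := by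
    intro f x
    rw [oscillator, sub_apply,
      SchwartzMap.smulLeftCLM_apply_apply hasTemperateGrowth_norm_sq_ofReal, smul_eq_mul]
  have h2 : ∀ (f : 𝓢(Plane, ℂ)) (x : Plane), ((‖x‖ ^ 2 : ℝ) : ℂ) * f x =
      SchwartzMap.smulLeftCLM ℂ (fun x : Plane => ((‖x‖ ^ 2 : ℝ) : ℂ)) f x := by
    intro f x
    rw [SchwartzMap.smulLeftCLM_apply_apply hasTemperateGrowth_norm_sq_ofReal, smul_eq_mul]
  simp only [h1, sub_mul, mul_sub]
  rw [integral_sub, integral_sub, SchwartzMap.integral_mul_laplacian_right_eq_left]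
  · congr 2
    ext x
    ring
  · simp only [h2]; exact hi _ _
  · exact hi _ _
  · simp only [h2]; exact hi _ _
  · exact hi _ _

theorem harmonicOscillator_apply (u : L2) (g : 𝓢(Plane, ℂ)) :
    harmonicOscillator (Lp.toTemperedDistribution u) g = pairL u (oscillator g) := by
  have h1 : harmonicOscillator (Lp.toTemperedDistribution u) =
      TemperedDistribution.smulLeftCLM ℂ (fun x : Plane => ((‖x‖ ^ 2 : ℝ) : ℂ))
        (Lp.toTemperedDistribution u) -
      LineDeriv.laplacianCLM ℂ Plane 𝓢'(Plane, ℂ) (Lp.toTemperedDistribution u) := rfl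
  rw [h1, TemperedDistribution.laplacianCLM_apply, oscillator, map_sub, pairL_eq, pairL_eq]
  rw [← TemperedDistribution.laplacian_apply_apply, ← TemperedDistribution.smulLeftCLM_apply_apply]
  rfl

theorem mem_eigenspace_iff {N : ℕ} {u : L2} :
    u ∈ eigenspace N ↔ ∀ g, pairL u (oscillator g) = (2 * N + 2 : ℂ) * pairL u g := by
  have h0 : u ∈ eigenspace N ↔ harmonicOscillator (Lp.toTemperedDistribution u) =
    (2 * N + 2 : ℂ) • Lp.toTemperedDistribution u := Iff.rfl
  rw [h0]
  constructor
  · intro h g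
    rw [← harmonicOscillator_apply, h]
    rfl
  · intro h
    ext g
    rw [harmonicOscillator_apply, h]
    rfl

theorem pairL_toL2 (f g : 𝓢(Plane, ℂ)) : pairL (toL2 f) g = ∫ x, g x * f x := by
  rw [pairL_apply]
  refine integral_congr_ae ?_
  filter_upwards [coeFn_toL2 f] with x hx
  rw [hx]

theorem toL2_mem_eigenspace {N : ℕ} {f : 𝓢(Plane, ℂ)} (hf : f ∈ hermiteSpan N) :
    toL2 f ∈ eigenspace N := by
  refine mem_eigenspace_iff.2 fun g => ?_
  rw [pairL_toL2, pairL_toL2, integral_oscillator_mul, oscillator_hermite hf, ← integral_const_mul]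
  congr 1
  ext x
  rw [smul_apply, smul_eq_mul]
  ring

theorem pairL_eq_zero_of_mem_eigenspace {N M : ℕ} (hMN : M ≠ N) {u : L2} (hu : u ∈ eigenspace N)
    {g : 𝓢(Plane, ℂ)} (hg : g ∈ hermiteSpan M) : pairL u g = 0 := by
  have h := mem_eigenspace_iff.1 hu g
  rw [oscillator_hermite hg, map_smul, smul_eq_mul] at h
  have h2 : ((M : ℂ) - N) * pairL u g = 0 := by linear_combination h / 2
  rcases mul_eq_zero.1 h2 with h3 | h3
  · exact absurd (Nat.cast_injective (sub_eq_zero.1 h3)) hMN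
  · exact h3

theorem pairL_sub (u v : L2) (g : 𝓢(Plane, ℂ)) : pairL (u - v) g = pairL u g - pairL v g := by
  rw [pairL_eq_inner, pairL_eq_inner, pairL_eq_inner, inner_sub_right]

/-- An `L²` function orthogonal to all Hermite functions of degree different from `N` is a
combination of Hermite functions of degree `N`. -/
theorem mem_map_of_pairL_eq_zero {N : ℕ} {u : L2}
    (h : ∀ M, M ≠ N → ∀ g ∈ hermiteSpan M, pairL u g = 0) : u ∈ (hermiteSpan N).map toL2 := by
  set K := (hermiteSpan N).map toL2
  set p := K.starProjection u
  have hp : p ∈ K := Submodule.starProjection_apply_mem K u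
  have hz : u - p = 0 := by
    refine eq_zero_of_pairL_eq_zero fun M g hg => ?_
    -- In degree `N` the remainder is orthogonal to `K` by construction. In any other degree `u`
    -- pairs to zero by hypothesis, and `p` because it is an eigenfunction for a different
    -- eigenvalue.
    by_cases hM : M = N
    · subst hM
      rw [pairL_eq_inner]
      exact (Submodule.mem_orthogonal K _).1 (Submodule.sub_starProjection_mem_orthogonal u) _
        (Submodule.mem_map_of_mem (conjS_mem hg))
    · obtain ⟨f, hf, hfp⟩ := hp
      rw [pairL_sub, h M hM g hg, ← hfp,
        pairL_eq_zero_of_mem_eigenspace hM (toL2_mem_eigenspace hf) hg, sub_zero]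
  rw [sub_eq_zero.1 hz]
  exact hp

theorem eigenspace_eq_map (N : ℕ) : eigenspace N = (hermiteSpan N).map toL2 := by
  apply le_antisymm
  · exact fun u hu => mem_map_of_pairL_eq_zero fun M hM g hg =>
      pairL_eq_zero_of_mem_eigenspace hM hu hg
  · rintro _ ⟨f, hf, rfl⟩
    exact toL2_mem_eigenspace hf

theorem finrank_eigenspace (N : ℕ) : Module.finrank ℂ (eigenspace N) = N + 1 := by
  rw [eigenspace_eq_map, ← finrank_hermiteSpan N]
  exact (Submodule.equivMapOfInjective toL2 toL2_injective (hermiteSpan N)).finrank_eq.symm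

instance (N : ℕ) : FiniteDimensional ℂ (eigenspace N) :=
  Module.finite_of_finrank_pos (by rw [finrank_eigenspace]; omega)

end Eigenspace

/-! ### Resonance condition and stability of the eigenspaces -/

section Stability

open scoped ENNReal ComplexConjugate

/-- The linear map `(x, z) ↦ c x + l x^⊥ + z`. -/
def corner (c l : ℝ) : Plane × Plane →L[ℝ] Plane :=
  (LinearMap.toContinuousLinearMap (similarity c l)).coprod (ContinuousLinearMap.id ℝ Plane)

theorem corner_apply (c l : ℝ) (p : Plane × Plane) :
    corner c l p = c • p.1 + l • perp p.1 + p.2 := by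
  rw [← similarity_apply]
  rfl

/-- The integrand of the quadrilinear form. -/
def formKernel (l : ℝ) (f₁ f₂ f₃ f₄ : Plane → ℂ) (p : Plane × Plane) : ℂ :=
  (f₁ (corner 1 0 p) * f₂ (corner 0 l p)) * (conj (f₃ (corner 1 l p)) * conj (f₄ (corner 0 0 p)))

theorem crForm_eq (l : ℝ) (f₁ f₂ f₃ f₄ : Plane → ℂ) :
    crForm l f₁ f₂ f₃ f₄ = ∫ x, ∫ z, formKernel l f₁ f₂ f₃ f₄ (x, z) := by
  simp only [crForm, formKernel, corner_apply, one_smul, zero_smul, add_zero, zero_add, mul_assoc]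

theorem integrable_formKernel (l : ℝ) (f₁ f₂ f₃ f₄ : 𝓢(Plane, ℂ)) :
    Integrable (formKernel l f₁ f₂ f₃ f₄) (volume.prod volume) := by
  have hc : Continuous (starRingEnd ℂ) := Complex.continuous_conj
  have hcont : Continuous (formKernel l f₁ f₂ f₃ f₄) := by
    unfold formKernel
    fun_prop
  refine ⟨hcont.aestronglyMeasurable, ?_⟩
  rw [HasFiniteIntegral]
  have e : ∀ p, ‖formKernel l f₁ f₂ f₃ f₄ p‖ₑ =
      (‖f₁ (corner 1 0 p)‖ₑ * ‖f₂ (corner 0 l p)‖ₑ) *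
        (‖f₃ (corner 1 l p)‖ₑ * ‖f₄ (corner 0 0 p)‖ₑ) := by
    intro p
    have hn : ∀ w : ℂ, ‖conj w‖ₑ = ‖w‖ₑ := fun w => by
      rw [← ofReal_norm, RCLike.norm_conj, ofReal_norm]
    simp only [formKernel, enorm_mul, hn]
  simp_rw [e]
  have hm1 : Measurable fun p => ‖f₁ (corner 1 0 p)‖ₑ * ‖f₂ (corner 0 l p)‖ₑ := by fun_prop
  have hm2 : Measurable fun p => ‖f₃ (corner 1 l p)‖ₑ * ‖f₄ (corner 0 0 p)‖ₑ := by fun_prop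
  have hle := sq_lintegral_mul_le ((volume : Measure Plane).prod (volume : Measure Plane)) hm1 hm2
  have hN : ∀ f : 𝓢(Plane, ℂ), normSq2 f < ∞ := fun f => normSq2_lt_top (f.memLp 2 volume)
  have b1 : ∫⁻ p, (‖f₁ (corner 1 0 p)‖ₑ * ‖f₂ (corner 0 l p)‖ₑ) ^ 2 ∂(volume.prod volume) < ∞ := by
    rw [lintegral_prod _ (by fun_prop)]
    simp only [corner_apply, one_smul, zero_smul, add_zero, zero_add, mul_pow]
    rw [lintegral_lintegral_corner l (g := fun x => ‖f₁ x‖ₑ ^ 2) (h := fun x => ‖f₂ x‖ₑ ^ 2)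
      (by fun_prop) (by fun_prop)]
    exact ENNReal.mul_lt_top ENNReal.ofReal_lt_top (ENNReal.mul_lt_top (hN f₁) (hN f₂))
  have b2 : ∫⁻ p, (‖f₃ (corner 1 l p)‖ₑ * ‖f₄ (corner 0 0 p)‖ₑ) ^ 2 ∂(volume.prod volume) < ∞ := by
    rw [lintegral_prod_symm _ (by fun_prop)]
    simp only [corner_apply, zero_smul, add_zero, zero_add, mul_pow]
    have : ∀ z : Plane, ∫⁻ x, ‖f₃ ((1 : ℝ) • x + l • perp x + z)‖ₑ ^ 2 * ‖f₄ z‖ₑ ^ 2 =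
        ENNReal.ofReal (1 ^ 2 + l ^ 2)⁻¹ * normSq2 f₃ * ‖f₄ z‖ₑ ^ 2 := by
      intro z
      rw [lintegral_mul_const _ (by
        have h₀ := continuous_perp
        exact Continuous.measurable (by fun_prop)), lintegral_similarity_add (c := 1) (l := l) (by positivity) z
        (g := fun x => ‖f₃ x‖ₑ ^ 2) (by fun_prop)]
      rfl
    simp_rw [this]
    rw [lintegral_const_mul _ (by fun_prop)]
    exact ENNReal.mul_lt_top (ENNReal.mul_lt_top ENNReal.ofReal_lt_top (hN f₃)) (hN f₄)
  simpa using hle.trans_lt (ENNReal.mul_lt_top b1 b2)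

theorem crForm_eq_integral (l : ℝ) (f₁ f₂ f₃ f₄ : 𝓢(Plane, ℂ)) :
    crForm l f₁ f₂ f₃ f₄ = ∫ p, formKernel l f₁ f₂ f₃ f₄ p ∂(volume.prod volume) := by
  rw [integral_prod _ (integrable_formKernel l f₁ f₂ f₃ f₄), crForm_eq]

/-- The quadrilinear form is linear in its first argument. -/
def crFormL (l : ℝ) (f₂ f₃ f₄ : 𝓢(Plane, ℂ)) : 𝓢(Plane, ℂ) →ₗ[ℂ] ℂ where
  toFun f := crForm l f f₂ f₃ f₄
  map_add' f g := by
    rw [crForm_eq_integral, crForm_eq_integral, crForm_eq_integral,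
      ← integral_add (integrable_formKernel _ _ _ _ _) (integrable_formKernel _ _ _ _ _)]
    congr 1
    ext p
    simp only [formKernel, add_apply]
    ring
  map_smul' c f := by
    rw [crForm_eq_integral, crForm_eq_integral, RingHom.id_apply, smul_eq_mul, ← integral_const_mul]
    congr 1
    ext p
    simp only [formKernel, smul_apply, smul_eq_mul]
    ring

theorem crFormL_apply (l : ℝ) (f₁ f₂ f₃ f₄ : 𝓢(Plane, ℂ)) :
    crFormL l f₂ f₃ f₄ f₁ = crForm l f₁ f₂ f₃ f₄ := rfl

theorem inner_perp_left (x y : Plane) : inner ℝ (perp x) y = -inner ℝ x (perp y) := by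
  simp [perp, PiLp.inner_apply, Fin.sum_univ_two]

theorem perp_perp (x : Plane) : perp (perp x) = -x := by
  ext i; fin_cases i <;> simp [perp]

theorem perp_lin (a b : ℝ) (x y : Plane) : perp (a • x + b • y) = a • perp x + b • perp y := by
  ext i; fin_cases i <;> simp [perp]; ring

/-- The vector `(1 + l ^ 2)⁻¹ (e + l e^⊥)`. -/
def tilt (l : ℝ) (e : Plane) : Plane := (1 + l ^ 2)⁻¹ • e + ((1 + l ^ 2)⁻¹ * l) • perp e

theorem tilt_sub_perp (l : ℝ) (e : Plane) : tilt l e - l • perp (tilt l e) = e := by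
  have h : (1 + l ^ 2 : ℝ) ≠ 0 := by positivity
  rw [tilt, perp_lin, perp_perp]
  match_scalars
  · field_simp
    ring
  · ring

/-- A coordinate of the first vertex is a combination of coordinates of the third and fourth alone.
The vector `tilt l e` solves `w - l w^⊥ = e`, which makes the `x` parts agree. -/
theorem inner_corner (l : ℝ) (e : Plane) (p : Plane × Plane) :
    inner ℝ e (corner 1 0 p) =
      inner ℝ (tilt l e) (corner 1 l p) + inner ℝ (e - tilt l e) (corner 0 0 p) := by
  have h1 : inner ℝ e p.1 = inner ℝ (tilt l e) p.1 + l * inner ℝ (tilt l e) (perp p.1) := by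
    conv_lhs => rw [← tilt_sub_perp l e]
    rw [inner_sub_left, real_inner_smul_left, inner_perp_left]
    ring
  simp only [corner_apply, one_smul, zero_smul, add_zero, zero_add, inner_add_right,
    real_inner_smul_right, inner_sub_left, h1]
  ring

theorem hasFDerivAt_comp_corner (f : 𝓢(Plane, ℂ)) (c l : ℝ) (p : Plane × Plane) :
    HasFDerivAt (fun p => f (corner c l p)) ((fderiv ℝ f (corner c l p)).comp (corner c l)) p :=
  (f.hasFDerivAt _).comp p (corner c l).hasFDerivAt

theorem hasFDerivAt_conj_comp_corner (f : 𝓢(Plane, ℂ)) (c l : ℝ) (p : Plane × Plane) :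
    HasFDerivAt (fun p => conj (f (corner c l p)))
      ((Complex.conjCLE : ℂ →L[ℝ] ℂ).comp ((fderiv ℝ f (corner c l p)).comp (corner c l))) p :=
  (Complex.conjCLE : ℂ →L[ℝ] ℂ).hasFDerivAt.comp p (hasFDerivAt_comp_corner f c l p)

/-- Integration by parts along the direction `v` of `(x, z)` that fixes the second vertex and moves
the first by `e`. The third and fourth then move by `tilt l e` and `e - tilt l e`, the vectors of
`inner_corner`, so position and derivative combine into ladder operators. -/
theorem crForm_dirD (l : ℝ) (e : Plane) (f₁ f₂ f₃ f₄ : 𝓢(Plane, ℂ)) :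
    crForm l f₁ f₂ (dirD (tilt l e) f₃) f₄ + crForm l f₁ f₂ f₃ (dirD (e - tilt l e) f₄) =
      -crForm l (dirD e f₁) f₂ f₃ f₄ := by
  set v : Plane × Plane := (tilt l e, e - tilt l e)
  have c1 : corner 1 0 v = e := by simp [corner_apply, v]
  have c2 : corner 0 l v = 0 := by
    rw [corner_apply]
    simp only [v]
    conv_lhs => enter [2, 1]; rw [← tilt_sub_perp l e]
    module
  have c3 : corner 1 l v = tilt l e := by
    rw [corner_apply]
    simp only [v]
    conv_lhs => enter [2, 1]; rw [← tilt_sub_perp l e]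
    module
  have c4 : corner 0 0 v = e - tilt l e := by simp [corner_apply, v]
  have hf : ∀ p, HasLineDerivAt ℝ (fun p => f₁ (corner 1 0 p) * f₂ (corner 0 l p))
      ((dirD e f₁) (corner 1 0 p) * f₂ (corner 0 l p)) p v := by
    intro p
    have := ((hasFDerivAt_comp_corner f₁ 1 0 p).fun_mul (hasFDerivAt_comp_corner f₂ 0 l p)).hasLineDerivAt v
    have e' : (dirD e f₁) (corner 1 0 p) * f₂ (corner 0 l p) =
        (f₁ (corner 1 0 p) • (fderiv ℝ f₂ (corner 0 l p)).comp (corner 0 l) +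
          f₂ (corner 0 l p) • (fderiv ℝ f₁ (corner 1 0 p)).comp (corner 1 0)) v := by
      simp [c1, c2, dirD_apply, mul_comm]
    rw [e']
    exact this
  have hg : ∀ p, HasLineDerivAt ℝ (fun p => conj (f₃ (corner 1 l p)) * conj (f₄ (corner 0 0 p)))
      (conj (dirD (tilt l e) f₃ (corner 1 l p)) * conj (f₄ (corner 0 0 p)) +
        conj (f₃ (corner 1 l p)) * conj (dirD (e - tilt l e) f₄ (corner 0 0 p))) p v := by
    intro p
    have := ((hasFDerivAt_conj_comp_corner f₃ 1 l p).fun_mul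
      (hasFDerivAt_conj_comp_corner f₄ 0 0 p)).hasLineDerivAt v
    have e' : conj (dirD (tilt l e) f₃ (corner 1 l p)) * conj (f₄ (corner 0 0 p)) +
          conj (f₃ (corner 1 l p)) * conj (dirD (e - tilt l e) f₄ (corner 0 0 p)) =
        (conj (f₃ (corner 1 l p)) • (Complex.conjCLE : ℂ →L[ℝ] ℂ).comp
            ((fderiv ℝ f₄ (corner 0 0 p)).comp (corner 0 0)) +
          conj (f₄ (corner 0 0 p)) • (Complex.conjCLE : ℂ →L[ℝ] ℂ).comp
            ((fderiv ℝ f₃ (corner 1 l p)).comp (corner 1 l))) v := by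
      simp [c3, c4, dirD_apply]
      ring
    rw [e']
    exact this
  have hi1 := integrable_formKernel l f₁ f₂ (dirD (tilt l e) f₃) f₄
  have hi2 := integrable_formKernel l f₁ f₂ f₃ (dirD (e - tilt l e) f₄)
  have key := integral_bilinear_hasLineDerivAt_right_eq_neg_left_of_integrable
    (μ := (volume : Measure Plane).prod (volume : Measure Plane))
    (B := ContinuousLinearMap.mul ℝ ℂ) (v := v)
    (integrable_formKernel l (dirD e f₁) f₂ f₃ f₄)
    (by
      refine (hi1.add hi2).congr (Eventually.of_forall fun p => ?_)
      simp only [Pi.add_apply, formKernel, ContinuousLinearMap.mul_apply']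
      ring)
    (integrable_formKernel l f₁ f₂ f₃ f₄) (f := fun p => f₁ (corner 1 0 p) * f₂ (corner 0 l p))
    (g := fun p => conj (f₃ (corner 1 l p)) * conj (f₄ (corner 0 0 p)))
    (f' := fun p => (dirD e f₁) (corner 1 0 p) * f₂ (corner 0 l p))
    (g' := fun p => conj (dirD (tilt l e) f₃ (corner 1 l p)) * conj (f₄ (corner 0 0 p)) +
        conj (f₃ (corner 1 l p)) * conj (dirD (e - tilt l e) f₄ (corner 0 0 p)))
    (fun p _ => hf p) (fun p _ => hg p)
  rw [crForm_eq_integral, crForm_eq_integral, crForm_eq_integral, ← integral_add hi1 hi2]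
  refine Eq.trans ?_ key
  congr 1
  ext p
  simp only [formKernel, ContinuousLinearMap.mul_apply']
  ring

theorem crForm_mulX (l : ℝ) (e : Plane) (f₁ f₂ f₃ f₄ : 𝓢(Plane, ℂ)) :
    crForm l (mulX e f₁) f₂ f₃ f₄ =
      crForm l f₁ f₂ (mulX (tilt l e) f₃) f₄ + crForm l f₁ f₂ f₃ (mulX (e - tilt l e) f₄) := by
  rw [crForm_eq_integral, crForm_eq_integral, crForm_eq_integral,
    ← integral_add (integrable_formKernel _ _ _ _ _) (integrable_formKernel _ _ _ _ _)]
  congr 1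
  ext p
  simp only [formKernel, mulX_apply, map_mul, Complex.conj_ofReal]
  rw [inner_corner l e p]
  push_cast
  ring

theorem crForm_add_third (l : ℝ) (f₁ f₂ f g f₄ : 𝓢(Plane, ℂ)) :
    crForm l f₁ f₂ ⇑(f + g) f₄ = crForm l f₁ f₂ f f₄ + crForm l f₁ f₂ g f₄ := by
  rw [crForm_eq_integral, crForm_eq_integral, crForm_eq_integral,
    ← integral_add (integrable_formKernel _ _ _ _ _) (integrable_formKernel _ _ _ _ _)]
  congr 1
  ext p
  simp only [formKernel, add_apply, map_add]
  ring

theorem crForm_add_fourth (l : ℝ) (f₁ f₂ f₃ f g : 𝓢(Plane, ℂ)) :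
    crForm l f₁ f₂ f₃ ⇑(f + g) = crForm l f₁ f₂ f₃ f + crForm l f₁ f₂ f₃ g := by
  rw [← crForm_swap, crForm_add_third, crForm_swap l f₁ f₂ f₃ f, crForm_swap l f₁ f₂ f₃ g]

/-- A creation operator on the first argument of the quadrilinear form is moved to annihilation
operators on the last two arguments. -/
theorem crForm_raise (l : ℝ) (e : Plane) (f₁ f₂ f₃ f₄ : 𝓢(Plane, ℂ)) :
    crForm l (raise e f₁) f₂ f₃ f₄ =
      crForm l f₁ f₂ (lower (tilt l e) f₃) f₄ + crForm l f₁ f₂ f₃ (lower (e - tilt l e) f₄) := by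
  rw [lower_eq, lower_eq, crForm_add_third, crForm_add_fourth, ← crFormL_apply, raise_eq, map_sub,
    crFormL_apply, crFormL_apply, crForm_mulX]
  linear_combination -crForm_dirD l e f₁ f₂ f₃ f₄

theorem crForm_zero_third (l : ℝ) (f₁ f₂ f₄ : 𝓢(Plane, ℂ)) :
    crForm l f₁ f₂ ⇑(0 : 𝓢(Plane, ℂ)) f₄ = 0 := by
  simp [crForm]

theorem crForm_zero_fourth (l : ℝ) (f₁ f₂ f₃ : 𝓢(Plane, ℂ)) :
    crForm l f₁ f₂ f₃ ⇑(0 : 𝓢(Plane, ℂ)) = 0 := by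
  simp [crForm]

theorem crForm_eq_zero_of_lower {l : ℝ} {a : ℕ} {f₁ f₂ f₃ f₄ : 𝓢(Plane, ℂ)}
    (h₁ : f₁ ∈ hermiteSpan (a + 1))
    (h : ∀ f ∈ hermiteSpan a, ∀ e e', crForm l f f₂ (lower e f₃) f₄ = 0 ∧
      crForm l f f₂ f₃ (lower e' f₄) = 0) : crForm l f₁ f₂ f₃ f₄ = 0 := by
  have : hermiteSpan (a + 1) ≤ LinearMap.ker (crFormL l f₂ f₃ f₄) := by
    refine hermiteSpan_succ_le fun e f hf => ?_
    rw [LinearMap.mem_ker, crFormL_apply, crForm_raise, (h f hf _ (e - tilt l e)).1,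
      (h f hf (tilt l e) _).2, add_zero]
  exact LinearMap.mem_ker.1 (this h₁)

theorem crForm_eq_zero_of_ground {l : ℝ} {n₁ n₂ : ℕ} (hn : n₁ + n₂ ≠ 0)
    {f₁ f₂ f₃ f₄ : 𝓢(Plane, ℂ)} (h₁ : f₁ ∈ hermiteSpan n₁) (h₂ : f₂ ∈ hermiteSpan n₂)
    (h₃ : f₃ ∈ hermiteSpan 0) (h₄ : f₄ ∈ hermiteSpan 0) : crForm l f₁ f₂ f₃ f₄ = 0 := by
  have key : ∀ (a : ℕ) (f₁ f₂ f₃ f₄ : 𝓢(Plane, ℂ)), f₁ ∈ hermiteSpan (a + 1) →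
      f₃ ∈ hermiteSpan 0 → f₄ ∈ hermiteSpan 0 → crForm l f₁ f₂ f₃ f₄ = 0 :=
    fun a f₁ f₂ f₃ f₄ h₁ h₃ h₄ => crForm_eq_zero_of_lower h₁ fun f _ e e' =>
      ⟨by rw [lower_eq_zero h₃, crForm_zero_third], by rw [lower_eq_zero h₄, crForm_zero_fourth]⟩
  cases n₁ with
  | succ a => exact key a f₁ f₂ f₃ f₄ h₁ h₃ h₄
  | zero =>
    cases n₂ with
    | succ a => rw [← crForm_swap]; exact key a f₂ f₁ f₄ f₃ h₂ h₄ h₃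
    | zero => exact absurd rfl hn

/-- The resonance condition: the quadrilinear form vanishes on Hermite functions unless the degrees
balance. -/
theorem crForm_hermite_eq_zero (m : ℕ) : ∀ (l : ℝ) (n₁ n₂ n₃ n₄ : ℕ), n₁ + n₂ = m →
    n₁ + n₂ ≠ n₃ + n₄ → ∀ f₁ ∈ hermiteSpan n₁, ∀ f₂ ∈ hermiteSpan n₂, ∀ f₃ ∈ hermiteSpan n₃,
      ∀ f₄ ∈ hermiteSpan n₄, crForm l f₁ f₂ f₃ f₄ = 0 := by
  induction m with
  | zero =>
    intro l n₁ n₂ n₃ n₄ hm hn f₁ h₁ f₂ h₂ f₃ h₃ f₄ h₄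
    obtain ⟨rfl, rfl⟩ : n₁ = 0 ∧ n₂ = 0 := by omega
    -- With ground states in the first two slots, the form is read backwards: some creation operator
    -- sits in the last two slots and turns into annihilations of ground states.
    rw [← crForm_conj, crForm_eq_zero_of_ground (n₁ := n₄) (n₂ := n₃) (by omega) h₄ h₃ h₂ h₁,
      map_zero]
  | succ m ih =>
    have key : ∀ (l : ℝ) (a n₂ n₃ n₄ : ℕ), a + n₂ = m → a + 1 + n₂ ≠ n₃ + n₄ →
        ∀ f₁ ∈ hermiteSpan (a + 1), ∀ f₂ ∈ hermiteSpan n₂, ∀ f₃ ∈ hermiteSpan n₃,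
        ∀ f₄ ∈ hermiteSpan n₄, crForm l f₁ f₂ f₃ f₄ = 0 := by
      intro l a n₂ n₃ n₄ hm hn f₁ h₁ f₂ h₂ f₃ h₃ f₄ h₄
      refine crForm_eq_zero_of_lower h₁ fun f hf e e' => ⟨?_, ?_⟩
      · cases n₃ with
        | zero => rw [lower_eq_zero h₃, crForm_zero_third]
        | succ b => exact ih l a n₂ b n₄ hm (by omega) f hf f₂ h₂ _ (lower_mem h₃ e) f₄ h₄
      · cases n₄ with
        | zero => rw [lower_eq_zero h₄, crForm_zero_fourth]
        | succ b => exact ih l a n₂ n₃ b hm (by omega) f hf f₂ h₂ f₃ h₃ _ (lower_mem h₄ e')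
    intro l n₁ n₂ n₃ n₄ hm hn f₁ h₁ f₂ h₂ f₃ h₃ f₄ h₄
    cases n₁ with
    | succ a => exact key l a n₂ n₃ n₄ (by omega) hn f₁ h₁ f₂ h₂ f₃ h₃ f₄ h₄
    | zero =>
      cases n₂ with
      | zero => omega
      | succ a =>
        rw [← crForm_swap]
        exact key l a 0 n₄ n₃ (by omega) (by omega) f₂ h₂ f₁ h₁ f₄ h₄ f₃ h₃

theorem crForm_congr {l : ℝ} {f₁ f₂ f₃ f₄ g₁ g₂ g₃ g₄ : Plane → ℂ}
    (h₁ : f₁ =ᵐ[volume] g₁) (h₂ : f₂ =ᵐ[volume] g₂) (h₃ : f₃ =ᵐ[volume] g₃)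
    (h₄ : f₄ =ᵐ[volume] g₄) : crForm l f₁ f₂ f₃ f₄ = crForm l g₁ g₂ g₃ g₄ := by
  unfold crForm
  congr 1
  ext x
  refine integral_congr_ae ?_
  have e : ∀ {f g : Plane → ℂ}, f =ᵐ[volume] g → ∀ y : Plane, ∀ᵐ z, f (y + z) = g (y + z) :=
    fun h y => (measurePreserving_add_left volume y).quasiMeasurePreserving.ae_eq_comp h
  filter_upwards [e h₁ x, e h₂ (l • perp x), e h₃ (x + l • perp x), h₄] with z a b c d
  rw [a, b, c, d]

/-- The trilinear operator maps each eigenspace of the harmonic oscillator to itself. -/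
theorem crOp_mem_eigenspace {N : ℕ} {u₁ u₂ u₃ : L2} (h₁ : u₁ ∈ eigenspace N)
    (h₂ : u₂ ∈ eigenspace N) (h₃ : u₃ ∈ eigenspace N) : crOp u₁ u₂ u₃ ∈ eigenspace N := by
  rw [eigenspace_eq_map] at *
  obtain ⟨f₁, h₁, rfl⟩ := h₁
  obtain ⟨f₂, h₂, rfl⟩ := h₂
  obtain ⟨f₃, h₃, rfl⟩ := h₃
  refine mem_map_of_pairL_eq_zero fun M hM g hg => ?_
  rw [pairL_eq_inner, inner_crOp]
  refine integral_eq_zero_of_ae (Eventually.of_forall fun l => ?_)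
  beta_reduce
  rw [crForm_congr (coeFn_toL2 f₁) (coeFn_toL2 f₂) (coeFn_toL2 f₃) (coeFn_toL2 (conjS g))]
  -- Resonance would require `N + N = N + M`, excluded by `M ≠ N`.
  exact crForm_hermite_eq_zero (N + N) l N N N M rfl (by omega) f₁ h₁ f₂ h₂ f₃ h₃ _ (conjS_mem hg)

end Stability

/-! ### The flow on an eigenspace preserves Haar measure -/

section EigenFlow

open scoped ComplexConjugate

variable {N : ℕ}

instance instFiniteDimensionalRealEigenspace : FiniteDimensional ℝ (eigenspace N) :=
  Module.Finite.trans ℂ _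

/-- The orthogonal projection of `L²` onto `E_N`, as a real linear map. -/
def eigenProj (N : ℕ) : L2 →L[ℝ] eigenspace N :=
  (eigenspace N).orthogonalProjectionOnto.restrictScalars ℝ

/-- The inclusion of `E_N` in `L²`, as a real linear map. -/
def eigenIncl (N : ℕ) : eigenspace N →L[ℝ] L2 :=
  (eigenspace N).subtypeL.restrictScalars ℝ

theorem eigenIncl_apply (u : eigenspace N) : eigenIncl N u = u := rfl

theorem coe_eigenProj {u : L2} (hu : u ∈ eigenspace N) : (eigenProj N u : L2) = u :=
  Submodule.starProjection_eq_self_iff.2 hu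

theorem inner_eigenProj (u : eigenspace N) (v : L2) :
    inner ℂ u (eigenProj N v) = inner ℂ (u : L2) v :=
  Submodule.inner_orthogonalProjectionOnto_eq_of_mem_left u v

/-- The vector field of the resonant system restricted to `E_N`. -/
def eigenField (N : ℕ) (u : eigenspace N) : eigenspace N := eigenProj N (crField u)

theorem crField_mem {u : L2} (hu : u ∈ eigenspace N) : crField u ∈ eigenspace N :=
  neg_mem (Submodule.smul_mem _ _ (crOp_mem_eigenspace hu hu hu))

theorem coe_eigenField (u : eigenspace N) : (eigenField N u : L2) = crField u :=
  coe_eigenProj (crField_mem u.2)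

theorem contDiff_crField : ContDiff ℝ 1 crField := by
  have h : ContDiff ℝ 1 (fun u => crOpL u u u) := by fun_prop
  exact ((ContinuousLinearMap.lsmul ℝ ℂ Complex.I).contDiff.comp h).neg

theorem fderiv_crField_apply (u v : L2) :
    fderiv ℝ crField u v = -(Complex.I • (crOp u u v + crOp u v u + crOp v u u)) := by
  have h1 : HasFDerivAt (fun u => crOpL u u) _ u := crOpL.hasFDerivAt.clm_apply (hasFDerivAt_id u)
  have h2 : HasFDerivAt (fun u => crOpL u u u) _ u := h1.clm_apply (hasFDerivAt_id u)
  have h3 : HasFDerivAt crField _ u :=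
    ((ContinuousLinearMap.lsmul ℝ ℂ Complex.I).hasFDerivAt.comp u h2).neg
  rw [h3.fderiv]
  simp [crOpL_apply, add_assoc]

theorem contDiff_eigenField : ContDiff ℝ 1 (eigenField N) :=
  (eigenProj N).contDiff.comp (contDiff_crField.comp (eigenIncl N).contDiff)

theorem fderiv_eigenField_apply (u v : eigenspace N) :
    fderiv ℝ (eigenField N) u v = eigenProj N (fderiv ℝ crField u v) := by
  have h : HasFDerivAt (eigenField N)
      ((eigenProj N).comp ((fderiv ℝ crField u).comp (eigenIncl N))) u :=
    (eigenProj N).hasFDerivAt.comp u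
      ((contDiff_crField.differentiable one_ne_zero _).hasFDerivAt.comp u
        (eigenIncl N).hasFDerivAt)
  rw [h.fderiv]
  rfl

/-- The real basis `φₖ, i φₖ` of `E_N` attached to an orthonormal basis `φₖ`. -/
def realBasis (φ : OrthonormalBasis (Fin (N + 1)) ℂ (eigenspace N)) :
    Module.Basis (Fin 2 × Fin (N + 1)) ℝ (eigenspace N) :=
  Complex.basisOneI.smulTower φ.toBasis

/-- The vector field restricted to `E_N` is divergence-free. -/
theorem divergence_eigenField (φ : OrthonormalBasis (Fin (N + 1)) ℂ (eigenspace N))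
    (u : eigenspace N) :
    ∑ i, (realBasis φ).coord i (fderiv ℝ (eigenField N) u (realBasis φ i)) = 0 := by
  rw [Fintype.sum_prod_type, Finset.sum_comm]
  refine Finset.sum_eq_zero fun k _ => ?_
  have e : ∀ (c : ℂ) , φ.repr (eigenProj N (fderiv ℝ crField u ((c • φ k : eigenspace N) : L2))) k =
      -Complex.I * (conj c * inner ℂ (φ k : L2) (crOp u u (φ k)) +
        c * inner ℂ (φ k : L2) (crOp u (φ k) u) + c * inner ℂ (φ k : L2) (crOp (φ k) u u)) := by
    intro c
    rw [φ.repr_apply_apply, inner_eigenProj, fderiv_crField_apply, Submodule.coe_smul,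
      crOp_smul_left, crOp_smul_mid, crOp_smul_right, inner_neg_right, inner_smul_right,
      inner_add_right, inner_add_right, inner_smul_right, inner_smul_right, inner_smul_right]
    ring
  -- The complex-linear part of the derivative has real diagonal coefficients times `-i`, so it
  -- contributes nothing to the real trace. The antilinear part contributes opposite amounts along
  -- `φₖ` and `i φₖ`.
  have hA : (inner ℂ (φ k : L2) (crOp (φ k) u u)).im = 0 :=
    Complex.conj_eq_iff_im.1 (inner_crOp_conj _ _ _ _)
  have hB : (inner ℂ (φ k : L2) (crOp u (φ k) u)).im = 0 := by
    have h := inner_crOp_conj u (φ k) u (φ k)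
    rw [inner_crOp_swap] at h
    exact Complex.conj_eq_iff_im.1 h
  have h1 := e 1
  have h2 := e Complex.I
  rw [Fin.sum_univ_two]
  simp only [realBasis, Module.Basis.coord_apply, Module.Basis.smulTower_repr,
    Module.Basis.smulTower_apply, fderiv_eigenField_apply, OrthonormalBasis.coe_toBasis_repr_apply,
    OrthonormalBasis.coe_toBasis, Complex.coe_basisOneI, Complex.coe_basisOneI_repr,
    Matrix.cons_val_zero, Matrix.cons_val_one, h1, h2]
  simp [hA, hB]

theorem hasFDerivAt_eigenspace_norm_sq (u : eigenspace N) :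
    HasFDerivAt (fun v : eigenspace N => ‖v‖ ^ 2) ((2 • innerSL ℝ (u : L2)).comp (eigenIncl N)) u :=
  (hasFDerivAt_norm_sq (u : L2)).comp u (eigenIncl N).hasFDerivAt

theorem innerSL_eigenField (u : eigenspace N) :
    ((2 • innerSL ℝ (u : L2)).comp (eigenIncl N)) (eigenField N u) = 0 := by
  rw [ContinuousLinearMap.comp_apply, eigenIncl_apply, coe_eigenField]
  exact innerSL_crField _

theorem exists_lipschitzOnWith_eigenField (R : ℝ) :
    ∃ K, LipschitzOnWith K (eigenField N) (Metric.closedBall 0 R) := by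
  obtain ⟨K, hK⟩ := exists_lipschitzOnWith_crField R
  refine ⟨K, LipschitzOnWith.of_dist_le_mul fun u hu v hv => ?_⟩
  rw [Subtype.dist_eq, Subtype.dist_eq, coe_eigenField, coe_eigenField]
  rw [mem_closedBall_zero_iff] at hu hv
  exact hK.dist_le_mul u (mem_closedBall_zero_iff.2 hu) v (mem_closedBall_zero_iff.2 hv)

variable {Φ : ℝ → L2 → L2}

theorem IsCRFlow.hasDerivAt (hΦ : IsCRFlow Φ) (u : L2) (t : ℝ) :
    HasDerivAt (fun t => Φ t u) (crField (Φ t u)) t :=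
  isCRSolution_iff.1 (hΦ u).2 t

theorem IsCRFlow.eq_curve (hΦ : IsCRFlow Φ) {u : L2} {γ : ℝ → L2} (h0 : γ 0 = u)
    (hγ : ∀ t, HasDerivAt γ (crField (γ t)) t) (t : ℝ) : Φ t u = γ t :=
  congrFun (curve_unique hasFDerivAt_norm_sq innerSL_crField exists_lipschitzOnWith_crField
    (hΦ.hasDerivAt u) hγ (t₀ := 0) ((hΦ u).1.trans h0.symm)) t

theorem IsCRFlow.add (hΦ : IsCRFlow Φ) (s t : ℝ) (u : L2) : Φ (s + t) u = Φ s (Φ t u) :=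
  (hΦ.eq_curve (γ := fun s => Φ (s + t) u) (by simp)
    (fun s => (hΦ.hasDerivAt u (s + t)).comp_add_const s t) s).symm

theorem IsCRFlow.norm_eq (hΦ : IsCRFlow Φ) (t : ℝ) (u : L2) : ‖Φ t u‖ = ‖u‖ := by
  rw [norm_eq_of_curve hasFDerivAt_norm_sq innerSL_crField (hΦ.hasDerivAt u) t 0, (hΦ u).1]

theorem IsCRFlow.exists_lipschitzOnWith (hΦ : IsCRFlow Φ) (t R : ℝ) :
    ∃ C, LipschitzOnWith C (Φ t) (Metric.closedBall 0 R) := by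
  obtain ⟨C, hC⟩ := exists_dist_curve_le hasFDerivAt_norm_sq innerSL_crField
    exists_lipschitzOnWith_crField R t
  refine ⟨C, LipschitzOnWith.of_dist_le_mul fun u hu v hv => ?_⟩
  rw [mem_closedBall_zero_iff] at hu hv
  have := hC _ _ (hΦ.hasDerivAt u) (hΦ.hasDerivAt v) (by rwa [(hΦ u).1]) (by rwa [(hΦ v).1])
  rwa [(hΦ u).1, (hΦ v).1] at this

/-- The equation is solved inside `E_N`, where the field takes its values; uniqueness in `L²`
identifies this solution with the flow, which yields stability. -/
theorem IsCRFlow.exists_eigenCurve (hΦ : IsCRFlow Φ) (u : eigenspace N) :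
    ∃ γ : ℝ → eigenspace N, (∀ t, HasDerivAt γ (eigenField N (γ t)) t) ∧ ∀ t, Φ t u = γ t := by
  obtain ⟨γ, h0, hγ⟩ := exists_curve hasFDerivAt_eigenspace_norm_sq innerSL_eigenField
    exists_lipschitzOnWith_eigenField u
  refine ⟨γ, hγ, hΦ.eq_curve (γ := fun t => (γ t : L2)) (by rw [h0]) fun t => ?_⟩
  have := (eigenIncl N).hasFDerivAt.comp_hasDerivAt t (hγ t)
  rw [eigenIncl_apply, coe_eigenField] at this
  exact this

/-- The flow leaves the eigenspaces stable. -/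
theorem IsCRFlow.mapsTo (hΦ : IsCRFlow Φ) (N : ℕ) (t : ℝ) :
    Set.MapsTo (Φ t) (eigenspace N : Set L2) (eigenspace N : Set L2) := by
  intro u hu
  obtain ⟨γ, -, hγ⟩ := hΦ.exists_eigenCurve ⟨u, hu⟩
  have := hγ t
  rw [this]
  exact (γ t).2

/-- The flow restricted to the eigenspace `E_N`. -/
def IsCRFlow.restrict (hΦ : IsCRFlow Φ) (N : ℕ) (t : ℝ) (u : eigenspace N) : eigenspace N :=
  ⟨Φ t u, hΦ.mapsTo N t u.2⟩

theorem IsCRFlow.restrict_zero (hΦ : IsCRFlow Φ) (u : eigenspace N) : hΦ.restrict N 0 u = u :=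
  Subtype.ext (hΦ u).1

theorem IsCRFlow.restrict_add (hΦ : IsCRFlow Φ) (s t : ℝ) (u : eigenspace N) :
    hΦ.restrict N (s + t) u = hΦ.restrict N s (hΦ.restrict N t u) :=
  Subtype.ext (hΦ.add s t u)

theorem IsCRFlow.norm_restrict (hΦ : IsCRFlow Φ) (t : ℝ) (u : eigenspace N) :
    ‖hΦ.restrict N t u‖ = ‖u‖ := hΦ.norm_eq t u

theorem IsCRFlow.hasDerivAt_restrict (hΦ : IsCRFlow Φ) (u : eigenspace N) (t : ℝ) :
    HasDerivAt (fun s => hΦ.restrict N s u) (eigenField N (hΦ.restrict N t u)) t := by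
  obtain ⟨γ, hγ, h⟩ := hΦ.exists_eigenCurve u
  have : (fun s => hΦ.restrict N s u) = γ := funext fun s => Subtype.ext (h s)
  rw [show hΦ.restrict N t u = γ t from congrFun this t, this]
  exact hγ t

theorem IsCRFlow.exists_lipschitzOnWith_restrict (hΦ : IsCRFlow Φ) (t R : ℝ) :
    ∃ C : NNReal, LipschitzOnWith C (hΦ.restrict N t) (Metric.closedBall 0 R) := by
  obtain ⟨C, hC⟩ := hΦ.exists_lipschitzOnWith t R
  refine ⟨C, LipschitzOnWith.of_dist_le_mul fun u hu v hv => ?_⟩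
  rw [mem_closedBall_zero_iff] at hu hv
  exact hC.dist_le_mul u (mem_closedBall_zero_iff.2 hu) v (mem_closedBall_zero_iff.2 hv)

/-- The flow restricted to `E_N` preserves the Haar measures of `E_N`. -/
theorem IsCRFlow.measurePreserving_restrict (hΦ : IsCRFlow Φ)
    (φ : OrthonormalBasis (Fin (N + 1)) ℂ (eigenspace N)) (μ : Measure (eigenspace N))
    [μ.IsAddHaarMeasure] (t : ℝ) : MeasurePreserving (hΦ.restrict N t) μ μ :=
  measurePreserving_of_divergence_eq_zero μ contDiff_eigenField (realBasis φ)
    (divergence_eigenField φ) hΦ.restrict_zero hΦ.restrict_add hΦ.hasDerivAt_restrict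
    hΦ.norm_restrict hΦ.exists_lipschitzOnWith_restrict t

end EigenFlow

/-! ### Invariance of the Gaussian measure and recurrence -/

section Gaussian

open scoped ENNReal

theorem lintegral_pi_prod {E : Type*} [MeasurableSpace E] (μ : Measure E) [SigmaFinite μ] {n : ℕ}
    {f : Fin n → E → ℝ≥0∞} (hf : ∀ i, Measurable (f i)) :
    ∫⁻ x, ∏ i, f i (x i) ∂(Measure.pi fun _ => μ) = ∏ i, ∫⁻ x, f i x ∂μ := by
  induction n with
  | zero => simp
  | succ n ih =>
    have hm : Measurable fun x : Fin n → E => ∏ i : Fin n, f i.succ (x i) :=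
      Finset.measurable_prod _ fun i _ => (hf _).comp (measurable_pi_apply i)
    rw [(measurePreserving_piFinSuccAbove (fun _ : Fin (n + 1) => μ) 0).symm.lintegral_map_equiv]
    simp only [MeasurableEquiv.piFinSuccAbove_symm_apply, Fin.insertNthEquiv,
      Fin.prod_univ_succ, Fin.insertNth_zero, Equiv.coe_fn_mk, Fin.cons_succ, Fin.cons_zero]
    rw [← ih fun i => hf i.succ]
    exact lintegral_prod_mul (hf 0).aemeasurable hm.aemeasurable

theorem pi_withDensity {E : Type*} [MeasurableSpace E] (μ : Measure E) [SigmaFinite μ] (n : ℕ)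
    {ρ : E → ℝ≥0∞} (hρ : Measurable ρ) [SigmaFinite (μ.withDensity ρ)] :
    Measure.pi (fun _ : Fin n => μ.withDensity ρ) =
      (Measure.pi fun _ => μ).withDensity fun x => ∏ i, ρ (x i) := by
  refine Measure.pi_eq fun s hs => ?_
  rw [withDensity_apply _ (MeasurableSet.univ_pi hs), ← lintegral_indicator (MeasurableSet.univ_pi hs)]
  have e : ∀ x : Fin n → E, (Set.univ.pi s).indicator (fun x => ∏ i, ρ (x i)) x =
      ∏ i, (s i).indicator ρ (x i) := by
    intro x
    by_cases hx : x ∈ Set.univ.pi s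
    · rw [Set.indicator_of_mem hx]
      exact Finset.prod_congr rfl fun i _ => (Set.indicator_of_mem (hx i trivial) _).symm
    · rw [Set.indicator_of_notMem hx]
      simp only [Set.mem_univ_pi, not_forall] at hx
      obtain ⟨i, hi⟩ := hx
      exact (Finset.prod_eq_zero (Finset.mem_univ i) (Set.indicator_of_notMem hi _)).symm
  simp_rw [e]
  rw [lintegral_pi_prod μ fun i => hρ.indicator (hs i)]
  refine Finset.prod_congr rfl fun i _ => ?_
  rw [lintegral_indicator (hs i), withDensity_apply _ (hs i)]

theorem measurePreserving_withDensity {E : Type*} [MeasurableSpace E] {μ : Measure E} {T : E → E}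
    (hT : MeasurePreserving T μ μ) {ρ : E → ℝ≥0∞} (hρ : Measurable ρ) (h : ∀ x, ρ (T x) = ρ x) :
    MeasurePreserving T (μ.withDensity ρ) (μ.withDensity ρ) := by
  refine ⟨hT.measurable, Measure.ext fun s hs => ?_⟩
  rw [Measure.map_apply hT.measurable hs, withDensity_apply _ hs,
    withDensity_apply _ (hT.measurable hs), ← hT.setLIntegral_comp_preimage hs hρ]
  simp_rw [h]

theorem map_withDensity_comp {E F : Type*} [MeasurableSpace E] [MeasurableSpace F] (μ : Measure E)
    {T : E → F} (hT : Measurable T) {ρ : F → ℝ≥0∞} (hρ : Measurable ρ) :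
    (μ.withDensity (ρ ∘ T)).map T = (μ.map T).withDensity ρ := by
  refine Measure.ext fun s hs => ?_
  rw [Measure.map_apply hT hs, withDensity_apply _ hs, withDensity_apply _ (hT hs),
    setLIntegral_map hs hρ hT]
  rfl

variable {N : ℕ}

/-- The real linear isomorphism `c ↦ (N + 1)^{-1/2} ∑ₖ cₖ φₖ` of `ℂ^{N + 1}` onto `E_N`. -/
def gaussianEquiv (φ : OrthonormalBasis (Fin (N + 1)) ℂ (eigenspace N)) :
    (Fin (N + 1) → ℂ) ≃L[ℝ] eigenspace N :=
  (((WithLp.linearEquiv 2 ℂ (Fin (N + 1) → ℂ)).symm.trans φ.repr.symm.toLinearEquiv).trans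
    (LinearEquiv.smulOfNeZero ℂ _ ((Real.sqrt ((N : ℝ) + 1) : ℂ)⁻¹)
      (by
        have : Real.sqrt ((N : ℝ) + 1) ≠ 0 := by positivity
        exact inv_ne_zero (by exact_mod_cast this)))).restrictScalars ℝ |>.toContinuousLinearEquiv

theorem gaussianEquiv_apply (φ : OrthonormalBasis (Fin (N + 1)) ℂ (eigenspace N))
    (c : Fin (N + 1) → ℂ) :
    gaussianEquiv φ c = ((Real.sqrt ((N : ℝ) + 1) : ℂ)⁻¹) • ∑ k, c k • φ k :=
  congrArg (((Real.sqrt ((N : ℝ) + 1) : ℂ)⁻¹) • ·) (φ.sum_repr_symm (WithLp.toLp 2 c)).symm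

theorem norm_sq_gaussianEquiv (φ : OrthonormalBasis (Fin (N + 1)) ℂ (eigenspace N))
    (c : Fin (N + 1) → ℂ) : ((N : ℝ) + 1) * ‖gaussianEquiv φ c‖ ^ 2 = ∑ k, ‖c k‖ ^ 2 := by
  have h := φ.repr.symm.norm_map (WithLp.toLp 2 c)
  have hN : (0 : ℝ) ≤ (N : ℝ) + 1 := by positivity
  rw [← φ.sum_repr_symm] at h
  rw [gaussianEquiv_apply, norm_smul, mul_pow]
  have h' : ‖∑ k, c k • φ k‖ ^ 2 = ∑ k, ‖c k‖ ^ 2 := by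
    rw [← EuclideanSpace.norm_sq_eq (WithLp.toLp 2 c), ← h]
  rw [h', norm_inv, Complex.norm_real, inv_pow, Real.norm_of_nonneg (Real.sqrt_nonneg _),
    Real.sq_sqrt hN]
  field_simp

/-- The density of the Gaussian measure on `E_N`. -/
def gaussianDensity (N : ℕ) (u : eigenspace N) : ℝ≥0∞ :=
  ENNReal.ofReal (Real.pi⁻¹ ^ (N + 1) * Real.exp (-(((N : ℝ) + 1) * ‖u‖ ^ 2)))

theorem measurable_gaussianDensity : Measurable (gaussianDensity N) := by
  unfold gaussianDensity
  fun_prop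

instance instSigmaFiniteComplexGaussian : SigmaFinite complexGaussian := by
  unfold complexGaussian
  infer_instance

theorem pi_complexGaussian (φ : OrthonormalBasis (Fin (N + 1)) ℂ (eigenspace N)) :
    Measure.pi (fun _ : Fin (N + 1) => complexGaussian) =
      volume.withDensity (gaussianDensity N ∘ gaussianEquiv φ) := by
  have : SigmaFinite ((volume : Measure ℂ).withDensity
    (fun z => ENNReal.ofReal (Real.pi⁻¹ * Real.exp (-‖z‖ ^ 2)))) :=
      instSigmaFiniteComplexGaussian
  unfold complexGaussian
  rw [pi_withDensity _ _ (by fun_prop)]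
  rw [← volume_pi]
  congr 1
  ext c
  rw [← ENNReal.ofReal_prod_of_nonneg fun i _ => by positivity, Finset.prod_mul_distrib,
    Finset.prod_const, ← Real.exp_sum, Finset.sum_neg_distrib, Function.comp_apply,
    gaussianDensity, norm_sq_gaussianEquiv, Finset.card_univ, Fintype.card_fin]

theorem gammaN_eq {Ω : Type*} (φ : OrthonormalBasis (Fin (N + 1)) ℂ (eigenspace N))
    (g : Fin (N + 1) → Ω → ℂ) : gammaN φ g = gaussianEquiv φ ∘ fun ω k => g k ω := by
  ext1 ω
  rw [Function.comp_apply, gaussianEquiv_apply]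
  rfl

variable {Ω : Type*} [MeasurableSpace Ω] {P : Measure Ω} {g : Fin (N + 1) → Ω → ℂ}

theorem aemeasurable_family (hg : ∀ k, HasLaw (g k) complexGaussian P) :
    AEMeasurable (fun ω k => g k ω) P :=
  aemeasurable_pi_lambda _ fun k => (hg k).aemeasurable

variable [IsProbabilityMeasure P]

/-- Independence makes the joint law a product, and `norm_sq_gaussianEquiv` turns its density into a
function of the norm on `E_N`. The flow preserves the reference Haar measure and the norm, hence
this measure. -/
theorem muN_eq (hg : ∀ k, HasLaw (g k) complexGaussian P) (hi : iIndepFun g P)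
    (φ : OrthonormalBasis (Fin (N + 1)) ℂ (eigenspace N)) :
    muN P φ g = ((volume : Measure (Fin (N + 1) → ℂ)).map (gaussianEquiv φ)).withDensity
      (gaussianDensity N) := by
  have hm : Measurable (gaussianEquiv φ) := (gaussianEquiv φ).continuous.measurable
  rw [muN, gammaN_eq, ← AEMeasurable.map_map_of_aemeasurable hm.aemeasurable
    (aemeasurable_family hg), (iIndepFun_iff_map_fun_eq_pi_map fun k => (hg k).aemeasurable).1 hi]
  simp_rw [fun k => (hg k).map_eq]
  rw [pi_complexGaussian φ, map_withDensity_comp _ hm measurable_gaussianDensity]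

theorem isProbabilityMeasure_muN (hg : ∀ k, HasLaw (g k) complexGaussian P)
    (φ : OrthonormalBasis (Fin (N + 1)) ℂ (eigenspace N)) : IsProbabilityMeasure (muN P φ g) := by
  refine Measure.isProbabilityMeasure_map ?_
  rw [gammaN_eq]
  exact (gaussianEquiv φ).continuous.measurable.comp_aemeasurable (aemeasurable_family hg)

variable {Φ : ℝ → L2 → L2}

/-- The Gaussian measures are invariant under the flow. -/
theorem IsCRFlow.measurePreserving_muN (hΦ : IsCRFlow Φ)
    (hg : ∀ k, HasLaw (g k) complexGaussian P) (hi : iIndepFun g P)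
    (φ : OrthonormalBasis (Fin (N + 1)) ℂ (eigenspace N)) (t : ℝ) :
    MeasurePreserving (hΦ.restrict N t) (muN P φ g) (muN P φ g) := by
  rw [muN_eq hg hi φ]
  refine measurePreserving_withDensity (hΦ.measurePreserving_restrict φ _ t)
    measurable_gaussianDensity fun u => ?_
  rw [gaussianDensity, gaussianDensity, hΦ.norm_restrict]

theorem IsCRFlow.iterate_restrict (hΦ : IsCRFlow Φ) (n : ℕ) (u : eigenspace N) :
    (hΦ.restrict N 1)^[n] u = hΦ.restrict N n u := by
  induction n with
  | zero => rw [Function.iterate_zero_apply, Nat.cast_zero, hΦ.restrict_zero]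
  | succ n ih =>
    rw [Function.iterate_succ_apply', ih, ← hΦ.restrict_add, Nat.cast_succ, add_comm]

theorem exists_tendsto_of_frequently {X : Type*} [PseudoMetricSpace X] {u : ℕ → X} {x : X}
    (h : ∀ s ∈ 𝓝 x, ∃ᶠ n in atTop, u n ∈ s) :
    ∃ t : ℕ → ℕ, Tendsto t atTop atTop ∧ Tendsto (fun n => u (t n)) atTop (𝓝 x) := by
  have : MapClusterPt x atTop u := mapClusterPt_iff_frequently.2 h
  obtain ⟨t, ht, hx⟩ := this.tendsto_subseq
  exact ⟨t, ht.tendsto_atTop, hx⟩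

/-- Almost every trajectory is recurrent. -/
theorem IsCRFlow.ae_recurrent (hΦ : IsCRFlow Φ)
    (hg : ∀ k, HasLaw (g k) complexGaussian P) (hi : iIndepFun g P)
    (φ : OrthonormalBasis (Fin (N + 1)) ℂ (eigenspace N)) :
    ∀ᵐ u₀ : eigenspace N ∂(muN P φ g), ∃ t : ℕ → ℝ, Tendsto t atTop atTop ∧
      Tendsto (fun n => ‖Φ (t n) (u₀ : L2) - (u₀ : L2)‖) atTop (𝓝 0) := by
  have := isProbabilityMeasure_muN hg φ
  have := FiniteDimensional.proper ℝ (eigenspace N)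
  -- Poincaré recurrence for the time-one map, conservative because the invariant measure is finite.
  -- The return times obtained are integers.
  filter_upwards [(hΦ.measurePreserving_muN hg hi φ 1).conservative.ae_frequently_mem_of_mem_nhds]
    with u hu
  obtain ⟨t, ht, h⟩ := exists_tendsto_of_frequently hu
  refine ⟨fun n => t n, tendsto_natCast_atTop_atTop.comp ht, ?_⟩
  have h' := tendsto_iff_norm_sub_tendsto_zero.1 h
  simp_rw [hΦ.iterate_restrict] at h'
  exact h'

end Gaussian

end CRSystem

end

theorem theorem2p2 :
    (∃! Φ : ℝ → CRSystem.L2 → CRSystem.L2, CRSystem.IsCRFlow Φ) ∧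
    ∀ Φ : ℝ → CRSystem.L2 → CRSystem.L2, CRSystem.IsCRFlow Φ →
      ∀ N : ℕ, 1 ≤ N →
        Module.finrank ℂ (CRSystem.eigenspace N) = N + 1 ∧
        ∃ hstab : ∀ t : ℝ, Set.MapsTo (Φ t)
            (CRSystem.eigenspace N : Set CRSystem.L2) (CRSystem.eigenspace N : Set CRSystem.L2),
          ∀ (Ω : Type*) [MeasurableSpace Ω] (P : Measure Ω) [IsProbabilityMeasure P]
            (g : Fin (N + 1) → Ω → ℂ),
            (∀ k, HasLaw (g k) CRSystem.complexGaussian P) → iIndepFun g P →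
            ∀ φ : OrthonormalBasis (Fin (N + 1)) ℂ (CRSystem.eigenspace N),
              (∀ t : ℝ, MeasurePreserving
                (fun u : CRSystem.eigenspace N =>
                  (⟨Φ t u, hstab t u.2⟩ : CRSystem.eigenspace N))
                (CRSystem.muN P φ g) (CRSystem.muN P φ g)) ∧
              ∀ᵐ u₀ : CRSystem.eigenspace N ∂(CRSystem.muN P φ g),
                ∃ t : ℕ → ℝ, Tendsto t atTop atTop ∧
                  Tendsto (fun n => ‖Φ (t n) (u₀ : CRSystem.L2) - (u₀ : CRSystem.L2)‖)
                    atTop (𝓝 0) := by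
  refine ⟨CRSystem.existsUnique_crFlow, fun Φ hΦ N _ => ⟨CRSystem.finrank_eigenspace N,
    hΦ.mapsTo N, fun Ω _ P _ g hg hi φ => ⟨?_, hΦ.ae_recurrent hg hi φ⟩⟩⟩
  exact hΦ.measurePreserving_muN hg hi φ
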